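/- **Setting.** Let $X$ be a smooth manifold, $R=C^\infty(X)$. For a real Lie algebroid $A\to X$ with anchor $\rho$, let $\mathcal X=[X/A]$ be its formal quotient stack, with atlas $q:X\to\mathcal X$; forms and vector-valued forms on $\mathcal X$ are those on the graded manifold $A[1]$, bigraded by form degree and cohomological degree, and $\delta$ is the Lie derivative along the homological vector field (up to the usual sign). Thus $\Omega^{p,0}_{\mathcal X}=\Omega^p(X)$; an element of $\Omega^{p,1}_{\mathcal X}$ is a differential operator $\Gamma(A)\to\Omega^p(X)$ with symbol in $A^*\otimes\Omega^{p-1}(X)$; $\Omega^p(T_{\mathcal X})^{-1}=\Omega^p(X,A)$; an element of $\Omega^1(T_{\mathcal X})^0$ is a triple $(D,l,r)$ with $l\in\mathrm{End}(A)$, $r\in \mathrm{End}(TX)$ and $D:\Gamma(A)\to\Omega^1(X,A)$, $D_y(fa)=fD_ya+y(f)\,l(a)-r(y)(f)\,a$; and everything of cohomological degree below $0$ (for forms), resp. below $-1$ (for vector-valued forms), vanishes. *Shifted symplectic structures.* A $1$-shifted symplectic structure on $\mathcal X$ is $\omega=(\omega_0,\omega_1)\in\Omega^{2,1}_{\mathcal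 X}\times\Omega^{3,0}_{\mathcal X}$ with $\delta\omega_0=0$, $d\omega_0+\delta\omega_1=0$, $d\omega_1=0$, such that $\omega_0^\flat:\mathbb T_{\mathcal X}\to\mathbb T^\vee_{\mathcal X}[1]$ is an equivalence. Write $\sigma:A\to T^*X$ for the symbol of $\omega_0$. *Homotopy holomorphic structures.* A homotopy holomorphic structure on $\mathcal X$ is a pair $(\mathcal I,\mathcal Q)$, $\mathcal I=\mathcal I_1+\mathcal I_2$ with $\mathcal I_p\in\Omega^p(T_{\mathcal X})^{1-p}$, $\mathcal Q=\mathcal Q_1\in\Omega^1(T_{\mathcal X})^{-1}$ (further terms vanish for degree reasons), with $$[\mathcal I,\mathcal Q]_{NR}=0,\qquad \delta\mathcal I+\tfrac12[\mathcal I,\mathcal I]_{FN}=0,\qquad \delta\mathcal Q+[\mathcal I,\mathcal Q]_{FN}+\sum_p p\,\iota_{\mathcal I_p}\mathcal I=-1 ,$$ where $\iota_KL$ is the insertion of $K$ into $L$, so that the last sum is $\mathcal I_1\circ\mathcal I_1$ in form degree $1$ and $\iota_{\mathcal I_1}\mathcal I_2+2\,\mathcal I_1\circ\mathcal I_2$ in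 form degree $2$. With $\mathcal I_1=(D,l,r)$, the endomorphism $\mathbb J(y,a)=(-ry+\rho a,\ \mathcal Q_1y+la)$ of $TX\oplus A$ then satisfies $\mathbb J^2=-1$, and $L=\ker(\mathbb J-i)\subset (TX\oplus A)\otimes\mathbb C$, with anchor $(y,a)\mapsto y$ and bracket $$[(y,a),(z,b)]=\Bigl([y,z],\ \tfrac1{2i}\bigl([a,b]+D_yb-D_za+\mathcal Q_1[y,z]+\mathcal I_2(y,z)\bigr)\Bigr),$$ is the complex Lie algebroid on $X$ that presents the quotient $[X/L]$ of $\mathcal X$ by its anti-holomorphic foliation; the quotient map is $a\mapsto(\rho a,la+ia)$ on Lie algebroids. *Homotopy holomorphic $1$-shifted symplectic structures.* Such a structure on $\mathcal X$ consists of $(\mathcal I,\mathcal Q)$, a $1$-shifted symplectic structure $\omega$, and a closed complex two-form of degree $1$ on $[X/L]$ whose pullback to $\mathcal X$ has imaginary part $\omega$. Explicitly the latter is a complex linear $S:L\to T^*X\otimes\mathbb C$, necessarily of the form $S(y,a)=\sigma(a)+b(y)$ for a real $b:TX\to T^*X$, and a closed three-form $H=\eta+i\omega_1$, with $S(u)(z)+S(v)(y)=0$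 and $S([u,v])=\mathcal L_yS(v)-\iota_z\,dS(u)-\iota_z\iota_yH$ for sections $u,v$ of $L$ over $y,z$. The pair $(b,\eta)$ is the homotopy data. A Lagrangian structure on $q:X\to\mathcal X$ is $\gamma'+i\gamma$ with $\gamma,\gamma'\in\Omega^2(X)$, $d\gamma=\omega_1$, $d\gamma'=\eta$, such that the map $\gamma^\flat:A\simeq\mathbb T_{X/\mathcal X}\to T^*X$, $a\mapsto\sigma(a)-\gamma(\rho a)$, is an isomorphism. *Equivalences.* An equivalence between two quotients $[X/A]$, $[X/B]$ with such structures and with Lagrangian structures on their atlas $X$ is an isomorphism $\varphi:A\to B$ of Lie algebroids, a homotopy $k\in\Omega^1(X,B)$ whose gauge transformation ($\mathcal I_1\mapsto\mathcal I_1+\delta k$, $\mathcal I_2\mapsto\mathcal I_2+[\mathcal I_1,k]_{FN}+\frac12[\delta k,k]_{FN}$, $\mathcal Q_1\mapsto\mathcal Q_1-k\circ\mathcal I_1-\mathcal I_1\circ k-k\rho k$) takes $\varphi_*(\mathcal I,\mathcal Q)$ to the second pair, and a form $\mu=\lambda'+i\lambda\in\Omega^2(X)\otimes\mathbb C$ such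 that, under the isomorphism $(y,a)\mapsto(y,\varphi a+ky)$ of the Lie algebroids $L$, the second two-form is the first one plus $(d+\delta)\mu$, and the second Lagrangian structure is the first one plus $\mu$. *Generalized complex structures.* A generalized complex structure on $X$ is an endomorphism $\mathbf J=\begin{pmatrix}-I&P\\Q&{}^tI\end{pmatrix}$ of $TX\oplus T^*X$ with $\mathbf J^2=-1$, preserving the natural pairing and integrable for the Courant bracket. **Theorem.** (1) Let $\mathbf J$ be a generalized complex structure on $X$. Then $P$ is a Poisson bivector, so that $T^*X$ with anchor $P$ and bracket $[\alpha,\beta]=\mathcal L_{P\alpha}\beta-\iota_{P\beta}d\alpha$ is a Lie algebroid; let $\mathcal X=[X/T^*X]$. The following is a homotopy holomorphic structure on $\mathcal X$: $\mathcal I_1=(D,{}^tI,I)$ with $D_y\alpha=\iota_yd({}^tI\alpha)-\iota_{Iy}d\alpha$, $\mathcal I_2=dQ\in\Omega^2(X,T^*X)$, $\mathcal Q_1=Q$. Together with the canonical $1$-shifted symplectic structure $\omega$ ($\omega_0=d:\Gamma(T^*X)\to\Omega^2(X)$, $\omega_1=0$), and with $b=0$, $\eta=0$, it is a homotopy holomorphic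 $1$-shifted symplectic structure on $\mathcal X$, for which $\gamma=\gamma'=0$ is a Lagrangian structure on $X\to\mathcal X$. (2) Conversely, let $A\to X$ be a real Lie algebroid, and let $[X/A]$ be equipped with a homotopy holomorphic $1$-shifted symplectic structure and a Lagrangian structure on $X\to[X/A]$. Then there is a unique generalized complex structure $\mathbf J$ on $X$ such that $[X/A]$, with these structures, is equivalent to the quotient $[X/T^*X]$ with the structures induced by $\mathbf J$ as in (1). In particular $A$ is isomorphic to the Poisson Lie algebroid of $P$. -/

import Mathlib

open scoped Manifold ContDiff

noncomputable section

namespace GCStack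

/-! ### Calculus on the base manifold

`R` stands for the algebra `C^∞(X)` of a manifold `X`.  Vector fields are derivations of `R`,
differential forms are alternating `R`-multilinear maps on vector fields. -/

section Calculus

variable {R : Type*} [CommRing R] [Algebra ℝ R]

/-- Vector fields, `Γ(TX)`. -/
abbrev VF (R : Type*) [CommRing R] [Algebra ℝ R] := Derivation ℝ R R

/-- One-forms, `Γ(T^*X)`. -/
abbrev Cov (R : Type*) [CommRing R] [Algebra ℝ R] := Module.Dual R (VF R)

/-- Sections of `T^*X ⊗ T^*X`; the value on `(y, z)` is `β y z`. -/
abbrev Bil (R : Type*) [CommRing R] [Algebra ℝ R] := VF R →ₗ[R] Cov R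

/-- Sections of `T^*X ⊗ T^*X ⊗ T^*X`; the value on `(y, z, w)` is `H y z w`. -/
abbrev Tri (R : Type*) [CommRing R] [Algebra ℝ R] := VF R →ₗ[R] VF R →ₗ[R] Cov R

/-- `β` is a two-form. -/
def IsTwoForm (β : Bil R) : Prop := ∀ y, β y y = 0

/-- `H` is a three-form. -/
def IsThreeForm (H : Tri R) : Prop := (∀ y, H y y = 0) ∧ ∀ y z, H y z z = 0

/-- The differential `df` of a function. -/
def dFun (f : R) : Cov R where
  toFun y := y f
  map_add' _ _ := rfl
  map_smul' _ _ := rfl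

/-- The Lie derivative `L_y β` of a one-form. -/
def lieD (y : VF R) (β : Cov R) : Cov R where
  toFun z := y (β z) - β ⁅y, z⁆
  map_add' z w := by simp only [map_add, lie_add]; ring
  map_smul' f z := by
    have h : ⁅y, f • z⁆ = f • ⁅y, z⁆ + y f • z := by
      ext g
      simp [Derivation.commutator_apply]
    rw [h]
    simp
    ring

/-- The contraction `ι_y dα`. -/
def iotaD (y : VF R) (α : Cov R) : Cov R := lieD y α - dFun (α y)

/-- The exterior derivative `dα` of a one-form. -/
def dOne (α : Cov R) : Bil R where
  toFun y := iotaD y α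
  map_add' y z := by
    ext w
    simp [iotaD, lieD, dFun]
    ring
  map_smul' f y := by
    ext w
    have h : ⁅f • y, w⁆ = f • ⁅y, w⁆ - w f • y := by
      ext g
      simp [Derivation.commutator_apply, Derivation.smul_apply]
      ring
    simp [iotaD, lieD, dFun, h]
    ring

/-- The Lie derivative of a bilinear form along `x`. -/
def lieBil (x : VF R) (β : Bil R) (y z : VF R) : R :=
  x (β y z) - β ⁅x, y⁆ z - β y ⁅x, z⁆

/-- The Lie derivative of a trilinear form along `x`. -/
def lieTri (x : VF R) (H : Tri R) (y z w : VF R) : R :=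
  x (H y z w) - H ⁅x, y⁆ z w - H y ⁅x, z⁆ w - H y z ⁅x, w⁆

/-- The exterior derivative of a two-form, as the one-form `dβ(y, z, -)`: for `β` alternating,
`dTwo β y z w = y β(z,w) - z β(y,w) + w β(y,z) - β([y,z],w) + β([y,w],z) - β([z,w],y)`. -/
def dTwo (β : Bil R) (y z : VF R) : Cov R :=
  lieD y (β z) - lieD z (β y) + dFun (β y z) - β ⁅y, z⁆

/-- The exterior derivative of a three-form. -/
def dThree (H : Tri R) (x y z w : VF R) : R :=
  x (H y z w) - y (H x z w) + z (H x y w) - w (H x y z)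
    - H ⁅x, y⁆ z w + H ⁅x, z⁆ y w - H ⁅x, w⁆ y z
    - H ⁅y, z⁆ x w + H ⁅y, w⁆ x z - H ⁅z, w⁆ x y

end Calculus

/-! ### Lie algebroids

A Lie algebroid is given through the `R`-module `A` of its smooth sections. -/

/-- The operations of a Lie algebroid: an anchor (a bundle map to `TX`, that is an `R`-linear map
on sections) and a bracket of sections. -/
structure Algebroid (R A : Type*) [CommRing R] [Algebra ℝ R] [AddCommGroup A] [Module R A] where
  anchor : A →ₗ[R] VF R
  bracket : A → A → A

/-- The laws of a Lie algebroid.  (`ℝ`-bilinearity of the bracket is additivity together with the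
Leibniz rule for constant functions.) -/
structure Algebroid.IsLie {R A : Type*} [CommRing R] [Algebra ℝ R] [AddCommGroup A] [Module R A]
    (𝒜 : Algebroid R A) : Prop where
  add_left : ∀ a b c, 𝒜.bracket (a + b) c = 𝒜.bracket a c + 𝒜.bracket b c
  add_right : ∀ a b c, 𝒜.bracket a (b + c) = 𝒜.bracket a b + 𝒜.bracket a c
  self : ∀ a, 𝒜.bracket a a = 0
  leibniz : ∀ (a : A) (f : R) (b : A),
    𝒜.bracket a (f • b) = f • 𝒜.bracket a b + (𝒜.anchor a) f • b
  jacobi : ∀ a b c, 𝒜.bracket a (𝒜.bracket b c) =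
    𝒜.bracket (𝒜.bracket a b) c + 𝒜.bracket b (𝒜.bracket a c)
  anchor_bracket : ∀ a b, 𝒜.anchor (𝒜.bracket a b) = ⁅𝒜.anchor a, 𝒜.anchor b⁆

/-- `P : T^*X → TX` is contraction with a Poisson bivector: it is skew and
`{f, g} = (P df) g` satisfies the Jacobi identity. -/
structure IsPoisson {R : Type*} [CommRing R] [Algebra ℝ R] (P : Cov R →ₗ[R] VF R) : Prop where
  skew : ∀ α β : Cov R, β (P α) = - α (P β)
  jacobi : ∀ f g h : R, P (dFun f) (P (dFun g) h) =
    P (dFun (P (dFun f) g)) h + P (dFun g) (P (dFun f) h)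

/-- The Poisson Lie algebroid: `T^*X` with anchor `P` and bracket
`[α, β] = L_{Pα} β - ι_{Pβ} dα`. -/
def poissonAlgebroid {R : Type*} [CommRing R] [Algebra ℝ R] (P : Cov R →ₗ[R] VF R) :
    Algebroid R (Cov R) where
  anchor := P
  bracket α β := lieD (P α) β - iotaD (P β) α

/-! ### Forms on the quotient stack `𝒳 = [X/A]`

Forms of form degree `p` and cohomological degree `q` on `𝒳` are the bihomogeneous forms on the
graded manifold `A[1]`; the internal differential `δ` is the Lie derivative along the homological
vector field of `A`.  For `q = 0` these are the `p`-forms on `X`; for `q = 1` they are the first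
order differential operators `Γ(A) → Ω^p(X)` with symbol in `A^* ⊗ Ω^{p-1}(X)`; for `q < 0` there
are none.  On `Ω^{p,0}` the differential is `δη = (-1)^p (a ↦ L_{ρa} η)`, with symbol
`(-1)^p (a ↦ ι_{ρa} η)`. -/

section Forms

variable {R A : Type*} [CommRing R] [Algebra ℝ R] [AddCommGroup A] [Module R A]

/-- An element `(ω₀, ω₁)` of `∏_p Ω^{2+p,1-p}` (the terms with `p ≥ 2` vanish): `ω₀` is the operator
`op : Γ(A) → Ω^2(X)` with symbol `symb : A → T^*X`, and `ω₁ = three` is a three-form on `X`. -/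
structure ShiftedForm (R A : Type*) [CommRing R] [Algebra ℝ R] [AddCommGroup A] [Module R A] where
  op : A → Bil R
  symb : A →ₗ[R] Cov R
  three : Tri R

/-- `ω` is a closed two-form of degree `1` on `[X/A]`. -/
structure ShiftedForm.IsClosed (𝒜 : Algebroid R A) (Ω : ShiftedForm R A) : Prop where
  /-- `ω₀` and `ω₁` are forms of the right kind -/
  op_form : ∀ a, IsTwoForm (Ω.op a)
  three_form : IsThreeForm Ω.three
  op_add : ∀ a b, Ω.op (a + b) = Ω.op a + Ω.op b
  op_smul : ∀ (f : R) a y z, Ω.op (f • a) y z =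
    f * Ω.op a y z + (y f * Ω.symb a z - z f * Ω.symb a y)
  /-- `δω₀ = 0` -/
  delta_op : ∀ a b y z, Ω.op (𝒜.bracket a b) y z =
    lieBil (𝒜.anchor a) (Ω.op b) y z - lieBil (𝒜.anchor b) (Ω.op a) y z
  delta_symb : ∀ a b, Ω.symb (𝒜.bracket a b) =
    lieD (𝒜.anchor a) (Ω.symb b) - Ω.op a (𝒜.anchor b)
  delta_skew : ∀ a b, Ω.symb a (𝒜.anchor b) + Ω.symb b (𝒜.anchor a) = 0
  /-- `dω₀ + δω₁ = 0` -/
  d_op : ∀ a y z w, dTwo (Ω.op a) y z w - lieTri (𝒜.anchor a) Ω.three y z w = 0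
  d_symb : ∀ a y z, (Ω.op a y z - dOne (Ω.symb a) y z) - Ω.three (𝒜.anchor a) y z = 0
  /-- `dω₁ = 0` -/
  d_three : ∀ x y z w, dThree Ω.three x y z w = 0

/-- Non-degeneracy of `ω₀`.  The map `ω₀^♭` from the tangent complex `A → TX` to the shifted dual
complex `T^*X → A^*` is an equivalence of complexes of vector bundles iff its mapping cone
`A → TX ⊕ T^*X → A^*`, with maps `a ↦ (ρ a, σ a)` and `(y, α) ↦ (a ↦ σ(a)(y) + α(ρ a))`, is exact.
This cone is self-dual up to sign, so exactness means that the first map is fibrewise injective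
(has a left inverse) and that its image is the kernel of the second one. -/
structure ShiftedForm.Nondegenerate (𝒜 : Algebroid R A) (Ω : ShiftedForm R A) : Prop where
  split : ∃ π : VF R × Cov R →ₗ[R] A, ∀ a, π (𝒜.anchor a, Ω.symb a) = a
  exact : ∀ (y : VF R) (α : Cov R), (∀ a, Ω.symb a y + α (𝒜.anchor a) = 0) →
    ∃ a, 𝒜.anchor a = y ∧ Ω.symb a = α

/-- `ω` is a `1`-shifted symplectic structure on `[X/A]`. -/
structure ShiftedForm.IsSymplectic (𝒜 : Algebroid R A) (Ω : ShiftedForm R A) : Prop where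
  closed : Ω.IsClosed 𝒜
  nondeg : Ω.Nondegenerate 𝒜

/-- The canonical two-form of degree `1` on `[X/T^*X]`: the operator `d : Γ(T^*X) → Ω^2(X)`, with
symbol the identity. -/
def canonicalForm (R : Type*) [CommRing R] [Algebra ℝ R] : ShiftedForm R (Cov R) where
  op := dOne
  symb := LinearMap.id
  three := 0

end Forms

/-! ### Vector-valued forms on `[X/A]` and homotopy holomorphic structures

`Ω^p(T_𝒳)^d` are the vector-valued `p`-forms of degree `d` on `A[1]`.  They vanish for `d < -1`,
and

* `Ω^p(T_𝒳)^{-1} = Ω^p(X, A)`;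
* `K ∈ Ω^1(T_𝒳)^0` is a triple `(op, l, r)`: the endomorphisms `r` of `TX` and `l` of `A` which it
  induces, and the operator `op : Γ(A) → Ω^1(X, A)` sending `a` to the Lie derivative of `K` along
  the vertical vector field `a`, written `op y a` for `y` a vector field;
* `K ∈ Ω^2(T_𝒳)^0` is likewise a triple `(op, symb, base)`, with `base ∈ Ω^2(X, TX)`,
  `symb : A → Ω^1(X, A)` the contraction with vertical vector fields and
  `op : Γ(A) → Ω^2(X, A)` the Lie derivative along them. -/

section VectorForms

variable {R A B : Type*} [CommRing R] [Algebra ℝ R] [AddCommGroup A] [Module R A]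
  [AddCommGroup B] [Module R B]

/-- The components of an element of `Ω^1(T_𝒳)^0`. -/
@[ext]
structure EndForm (R A : Type*) [CommRing R] [Algebra ℝ R] [AddCommGroup A] [Module R A] where
  op : VF R → A → A
  l : A →ₗ[R] A
  r : VF R →ₗ[R] VF R

/-- The triple `(op, l, r)` is an element of `Ω^1(T_𝒳)^0`. -/
structure EndForm.IsForm (K : EndForm R A) : Prop where
  add_left : ∀ y z a, K.op (y + z) a = K.op y a + K.op z a
  smul_left : ∀ (f : R) y a, K.op (f • y) a = f • K.op y a
  add_right : ∀ y a b, K.op y (a + b) = K.op y a + K.op y b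
  leibniz : ∀ y (f : R) a, K.op y (f • a) = f • K.op y a + y f • K.l a - (K.r y) f • a

/-- `h` is an element of `Ω^2(X, A) = Ω^2(T_𝒳)^{-1}`. -/
structure IsTwoFormValued (h : VF R → VF R → A) : Prop where
  add_left : ∀ x y z, h (x + y) z = h x z + h y z
  smul_left : ∀ (f : R) y z, h (f • y) z = f • h y z
  self : ∀ y, h y y = 0

/-- The components of an element of `Ω^2(T_𝒳)^0`. -/
structure TwoEndForm (R A : Type*) [CommRing R] [Algebra ℝ R] [AddCommGroup A] [Module R A] where
  op : A → VF R → VF R → A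
  symb : A → VF R → A
  base : VF R → VF R → VF R

/-- The internal differential `δ : Ω^1(X, A) → Ω^1(T_𝒳)^0`. -/
def deltaOne (𝒜 : Algebroid R A) (k : VF R →ₗ[R] A) : EndForm R A where
  op y a := 𝒜.bracket a (k y) - k ⁅𝒜.anchor a, y⁆
  l := k.comp 𝒜.anchor
  r := 𝒜.anchor.comp k

/-- The internal differential `δ : Ω^2(X, A) → Ω^2(T_𝒳)^0`; as `δ` has total degree one, it
carries a sign relative to `deltaOne`. -/
def deltaTwo (𝒜 : Algebroid R A) (h : VF R → VF R → A) : TwoEndForm R A where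
  op a y z := -(𝒜.bracket a (h y z) - h ⁅𝒜.anchor a, y⁆ z - h y ⁅𝒜.anchor a, z⁆)
  symb a z := -h (𝒜.anchor a) z
  base y z := -𝒜.anchor (h y z)

/-- `δK = 0` in `Ω^1(T_𝒳)^1`, for `K ∈ Ω^1(T_𝒳)^0`, in components: `K` is invariant under the
homological vector field, that is, `K` is a multiplicative `(1,1)` tensor. -/
structure EndForm.IsMultiplicative (𝒜 : Algebroid R A) (K : EndForm R A) : Prop where
  anchor_l : ∀ a, 𝒜.anchor (K.l a) = K.r (𝒜.anchor a)
  anchor_op : ∀ y a, 𝒜.anchor (K.op y a) = ⁅𝒜.anchor a, K.r y⁆ - K.r ⁅𝒜.anchor a, y⁆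
  l_bracket : ∀ a b, K.l (𝒜.bracket a b) = 𝒜.bracket a (K.l b) - K.op (𝒜.anchor b) a
  op_bracket : ∀ y a b, K.op y (𝒜.bracket a b) =
    (𝒜.bracket a (K.op y b) - K.op ⁅𝒜.anchor a, y⁆ b)
      - (𝒜.bracket b (K.op y a) - K.op ⁅𝒜.anchor b, y⁆ a)

/-- The composition `K ∘ K ∈ Ω^1(T_𝒳)^0` (the Nijenhuis-Richardson insertion of `K` in itself). -/
def EndForm.sq (K : EndForm R A) : EndForm R A where
  op y a := K.op (K.r y) a + K.l (K.op y a)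
  l := K.l.comp K.l
  r := K.r.comp K.r

/-- `½[K, K]_FN ∈ Ω^2(T_𝒳)^0`, the Nijenhuis torsion
`[Ky, Kz] - K[Ky, z] - K[y, Kz] + K²[y, z]` of `K` on `A[1]`. -/
def EndForm.torsion (K : EndForm R A) : TwoEndForm R A where
  op a y z := K.op z (K.op y a) - K.op y (K.op z a) - K.op ⁅K.r y, z⁆ a - K.op ⁅y, K.r z⁆ a
    + K.op (K.r ⁅y, z⁆) a + K.l (K.op ⁅y, z⁆ a)
  symb a z := K.op z (K.l a) - K.l (K.op z a)
  base y z := ⁅K.r y, K.r z⁆ - K.r ⁅K.r y, z⁆ - K.r ⁅y, K.r z⁆ + K.r (K.r ⁅y, z⁆)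

/-- The Frölicher-Nijenhuis bracket `[K, k]_FN ∈ Ω^2(X, A)` with `k ∈ Ω^1(X, A)`. -/
def EndForm.fnOne (K : EndForm R A) (k : VF R →ₗ[R] A) (y z : VF R) : A :=
  K.op z (k y) - K.op y (k z) - k ⁅K.r y, z⁆ - k ⁅y, K.r z⁆ + k (K.r ⁅y, z⁆) + K.l (k ⁅y, z⁆)

/-- The cyclic summand of the Frölicher-Nijenhuis bracket `[K, h]_FN ∈ Ω^3(X, A)`, `h ∈ Ω^2(X, A)`. -/
def EndForm.fnTwoAux (K : EndForm R A) (h : VF R → VF R → A) (x y z : VF R) : A :=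
  -K.op x (h y z) - h ⁅K.r x, y⁆ z - h ⁅x, K.r y⁆ z + h (K.r ⁅x, y⁆) z + K.l (h ⁅x, y⁆ z)

/-- The Frölicher-Nijenhuis bracket `[K, h]_FN ∈ Ω^3(X, A)` with `h ∈ Ω^2(X, A)`. -/
def EndForm.fnTwo (K : EndForm R A) (h : VF R → VF R → A) (x y z : VF R) : A :=
  K.fnTwoAux h x y z + K.fnTwoAux h y z x + K.fnTwoAux h z x y

/-- The data `(ℐ, 𝒬)` of a homotopy holomorphic structure on `[X/A]`:
`ℐ = ℐ₁ + ℐ₂ ∈ ∏_p Ω^p(T_𝒳)^{1-p}` and `𝒬 = 𝒬₁ ∈ ∏_p Ω^p(T_𝒳)^{-p}`, all other terms being zero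
for degree reasons. -/
@[ext]
structure HolData (R A : Type*) [CommRing R] [Algebra ℝ R] [AddCommGroup A] [Module R A] where
  I₁ : EndForm R A
  I₂ : VF R → VF R → A
  Q₁ : VF R →ₗ[R] A

/-- `(ℐ, 𝒬)` is a homotopy holomorphic structure on `[X/A]`:
`[ℐ, 𝒬]_NR = 0`, `δℐ + ½[ℐ, ℐ]_FN = 0` and `δ_ℐ 𝒬 + ½[ℐ, ℐ]_NR = -1`, where
`δ_ℐ = δ + [ℐ, -]_FN`.  Here `½[ℐ, ℐ]_NR` stands for `∑_p p ι_{ℐ_p} ℐ` (`ι_K L` is the insertion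
of `K` in `L`), that is `ℐ₁ ∘ ℐ₁` in form degree one and `ι_{ℐ₁} ℐ₂ + 2 ℐ₁ ∘ ℐ₂` in form degree
two; with these weights the third equation is preserved by `δ_ℐ`. -/
structure HolData.IsHomotopyHolomorphic (𝒜 : Algebroid R A) (S : HolData R A) : Prop where
  form₁ : S.I₁.IsForm
  form₂ : IsTwoFormValued S.I₂
  /-- `[ℐ, 𝒬]_NR = 0` -/
  comm : ∀ y, S.I₁.l (S.Q₁ y) = S.Q₁ (S.I₁.r y)
  /-- the component of `δℐ + ½[ℐ, ℐ]_FN = 0` in form degree one -/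
  mc_one : S.I₁.IsMultiplicative 𝒜
  /-- the component of `δℐ + ½[ℐ, ℐ]_FN = 0` in form degree two -/
  mc_two_base : ∀ y z, (deltaTwo 𝒜 S.I₂).base y z + S.I₁.torsion.base y z = 0
  mc_two_symb : ∀ a z, (deltaTwo 𝒜 S.I₂).symb a z + S.I₁.torsion.symb a z = 0
  mc_two_op : ∀ a y z, (deltaTwo 𝒜 S.I₂).op a y z + S.I₁.torsion.op a y z = 0
  /-- the component of `δℐ + ½[ℐ, ℐ]_FN = 0` in form degree three -/
  mc_three : ∀ x y z, S.I₁.fnTwo S.I₂ x y z = 0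
  /-- the component of `δ_ℐ 𝒬 + ½[ℐ, ℐ]_NR = -1` in form degree one -/
  sq_one_r : ∀ y, (deltaOne 𝒜 S.Q₁).r y + S.I₁.sq.r y = -y
  sq_one_l : ∀ a, (deltaOne 𝒜 S.Q₁).l a + S.I₁.sq.l a = -a
  sq_one_op : ∀ y a, (deltaOne 𝒜 S.Q₁).op y a + S.I₁.sq.op y a = 0
  /-- the component of `δ_ℐ 𝒬 + ½[ℐ, ℐ]_NR = -1` in form degree two -/
  sq_two : ∀ y z, S.I₁.fnOne S.Q₁ y z
    + (S.I₂ (S.I₁.r y) z + S.I₂ y (S.I₁.r z) + (2 : ℕ) • S.I₁.l (S.I₂ y z)) = 0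

/-- Transport of `(op, l, r)` along an isomorphism of vector bundles. -/
def EndForm.map (φ : A ≃ₗ[R] B) (K : EndForm R A) : EndForm R B where
  op y b := φ (K.op y (φ.symm b))
  l := (φ.toLinearMap.comp K.l).comp φ.symm.toLinearMap
  r := K.r

/-- Transport of `(ℐ, 𝒬)` along an isomorphism of vector bundles. -/
def HolData.map (φ : A ≃ₗ[R] B) (S : HolData R A) : HolData R B where
  I₁ := S.I₁.map φ
  I₂ y z := φ (S.I₂ y z)
  Q₁ := φ.toLinearMap.comp S.Q₁

/-- The gauge transformation of `(ℐ, 𝒬)` by a homotopy `k ∈ Ω^1(T_𝒳)^{-1} = Ω^1(X, A)`: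
`ℐ₁' = ℐ₁ + δk`, `ℐ₂' = ℐ₂ + [ℐ₁, k]_FN + ½[δk, k]_FN` and
`𝒬' = 𝒬 - k ∘ ℐ₁ - ℐ₁ ∘ k - k ∘ ρ ∘ k`. -/
def HolData.gauge (𝒜 : Algebroid R A) (k : VF R →ₗ[R] A) (S : HolData R A) : HolData R A where
  I₁ :=
    { op := fun y a => S.I₁.op y a + (deltaOne 𝒜 k).op y a
      l := S.I₁.l + (deltaOne 𝒜 k).l
      r := S.I₁.r + (deltaOne 𝒜 k).r }
  I₂ y z := S.I₂ y z + S.I₁.fnOne k y z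
    + (𝒜.bracket (k y) (k z) - k ⁅𝒜.anchor (k y), z⁆ - k ⁅y, 𝒜.anchor (k z)⁆
      + k (𝒜.anchor (k ⁅y, z⁆)))
  Q₁ := S.Q₁ - k.comp S.I₁.r - S.I₁.l.comp k - (k.comp 𝒜.anchor).comp k

end VectorForms

/-! ### Homotopy holomorphic `1`-shifted symplectic structures -/

section HolSymplectic

variable {R A B : Type*} [CommRing R] [Algebra ℝ R] [AddCommGroup A] [Module R A]
  [AddCommGroup B] [Module R B]

/-- The endomorphism `𝕁(y, a) = (-r y + ρ a, 𝒬₁ y + l a)` of `TX ⊕ A`; it squares to `-1` for a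
homotopy holomorphic structure. -/
def HolData.endo (𝒜 : Algebroid R A) (S : HolData R A) (w : VF R × A) : VF R × A :=
  (-S.I₁.r w.1 + 𝒜.anchor w.2, S.Q₁ w.1 + S.I₁.l w.2)

/-- The complex vector bundle `L = {u ∈ (TX ⊕ A) ⊗ ℂ | 𝕁 u = i u}`; a section `u₁ + i u₂` of the
complexification is the pair `(u₁, u₂)`.  With the anchor `(y, a) ↦ y` and the bracket
`[(y, a), (z, b)] = ([y, z], (2i)⁻¹([a, b] + ℐ₁(y) b - ℐ₁(z) a + 𝒬₁[y, z] + ℐ₂(y, z)))`, where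
`ℐ₁(y) b` is the operator of `ℐ₁`, it is the complex Lie algebroid over `X` whose quotient stack
`[X/L]` is the quotient of `𝒳` by its anti-holomorphic foliation. The quotient map is
`a ↦ (ρ a, l a + i a)` on Lie algebroids. -/
def HolData.InL (𝒜 : Algebroid R A) (S : HolData R A) (u : (VF R × A) × (VF R × A)) : Prop :=
  S.endo 𝒜 u.1 = -u.2 ∧ S.endo 𝒜 u.2 = u.1

/-- `2i` times the `A`-component of the bracket of `L`. -/
def HolData.bracketL (𝒜 : Algebroid R A) (S : HolData R A) (w v : VF R × A) : A :=
  𝒜.bracket w.2 v.2 + S.I₁.op w.1 v.2 - S.I₁.op v.1 w.2 + S.Q₁ ⁅w.1, v.1⁆ + S.I₂ w.1 v.1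

/-- Real part of the complex bilinear extension of a biadditive map. -/
def reExt {M N : Type*} [AddCommGroup N] (f : M → M → N) (u v : M × M) : N :=
  f u.1 v.1 - f u.2 v.2

/-- Imaginary part of the complex bilinear extension of a biadditive map. -/
def imExt {M N : Type*} [AddCommGroup N] (f : M → M → N) (u v : M × M) : N :=
  f u.1 v.2 + f u.2 v.1

/-- The data of a homotopy holomorphic `1`-shifted symplectic structure on `[X/A]`: a homotopy
holomorphic structure, a `1`-shifted symplectic structure `ω`, and the homotopy data
`(bil, three)` that make `ω` holomorphic.

A holomorphic closed two-form of degree `1` is one on `[X/L]`, that is, a complex linear map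
`S : L → T^*X ⊗ ℂ` (its symbol) and a complex three-form.  Every complex linear `S` can be written
uniquely as `S(y, a) = symb a + bil y`, with real `symb : A → T^*X` and `bil : TX → T^*X`. Its
pullback to `𝒳` has symbol `a ↦ (symb (l a) + bil (ρ a)) + i symb a`.  The imaginary part of the
form is to be `ω`, so `symb` is the symbol of `ω`, and the three-form is `three + i ω₁`. -/
structure HolSympData (R A : Type*) [CommRing R] [Algebra ℝ R] [AddCommGroup A] [Module R A] where
  hol : HolData R A
  Ω : ShiftedForm R A
  bil : Bil R
  three : Tri R

/-- The complex linear extension of this map, restricted to `L`, is the symbol `S` of the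
holomorphic form. -/
def HolSympData.tau (S : HolSympData R A) (w : VF R × A) : Cov R := S.Ω.symb w.2 + S.bil w.1

/-- `S` is a homotopy holomorphic `1`-shifted symplectic structure on `[X/A]`: `(ℐ, 𝒬)` is a
homotopy holomorphic structure, `ω` is a `1`-shifted symplectic structure, and `(S, H)`, with
`H = three + i ω₁`, is a closed two-form of degree `1` on `[X/L]`, that is `dH = 0` and, for
sections `u`, `v` of `L` over the complex vector fields `y`, `z`,
`S(u)(z) + S(v)(y) = 0` and `S([u, v]) = L_y S(v) - ι_z dS(u) - H(y, z, -)`. -/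
structure HolSympData.IsHolSymplectic (𝒜 : Algebroid R A) (S : HolSympData R A) : Prop where
  hol : S.hol.IsHomotopyHolomorphic 𝒜
  symplectic : S.Ω.IsSymplectic 𝒜
  three_form : IsThreeForm S.three
  three_closed : ∀ x y z w, dThree S.three x y z w = 0
  skew_re : ∀ u v, S.hol.InL 𝒜 u → S.hol.InL 𝒜 v →
    reExt (fun w w' => S.tau w w'.1 + S.tau w' w.1) u v = 0
  skew_im : ∀ u v, S.hol.InL 𝒜 u → S.hol.InL 𝒜 v →
    imExt (fun w w' => S.tau w w'.1 + S.tau w' w.1) u v = 0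
  /-- the real part of `S([u, v]) = L_y S(v) - ι_z dS(u) - H(y, z, -)`, multiplied by `2` -/
  bracket_re : ∀ u v, S.hol.InL 𝒜 u → S.hol.InL 𝒜 v →
    S.Ω.symb (imExt (S.hol.bracketL 𝒜) u v)
        + (2 : ℕ) • S.bil (reExt (fun w w' => ⁅w.1, w'.1⁆) u v) =
      (2 : ℕ) • (reExt (fun w w' => lieD w.1 (S.tau w') - iotaD w'.1 (S.tau w)) u v
        - (reExt (fun w w' => S.three w.1 w'.1) u v
          - imExt (fun w w' => S.Ω.three w.1 w'.1) u v))
  /-- the imaginary part of `S([u, v]) = L_y S(v) - ι_z dS(u) - H(y, z, -)`, multiplied by `2` -/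
  bracket_im : ∀ u v, S.hol.InL 𝒜 u → S.hol.InL 𝒜 v →
    -S.Ω.symb (reExt (S.hol.bracketL 𝒜) u v)
        + (2 : ℕ) • S.bil (imExt (fun w w' => ⁅w.1, w'.1⁆) u v) =
      (2 : ℕ) • (imExt (fun w w' => lieD w.1 (S.tau w') - iotaD w'.1 (S.tau w)) u v
        - (imExt (fun w w' => S.three w.1 w'.1) u v
          + reExt (fun w w' => S.Ω.three w.1 w'.1) u v))

/-- `γ' + i γ` is a Lagrangian structure on `X → [X/A]`.  The pullback of the holomorphic form to
`X` is `three + i ω₁`, and `γ' + i γ` is an isotropic structure if `dγ = ω₁` and `dγ' = three`.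
The relative tangent complex `TX ⊕ A → TX`, `(y, a) ↦ y - ρ a`, has cohomology
`{(ρ a, a)} ≅ A`, on which `γ^♭` is the map `a ↦ σ(a) - γ(ρ a)` to `T^*X`; the isotropic structure
is Lagrangian for `ω` if this is an isomorphism. -/
structure HolSympData.IsLagrangian (𝒜 : Algebroid R A) (S : HolSympData R A) (γ γ' : Bil R) :
    Prop where
  form : IsTwoForm γ
  form' : IsTwoForm γ'
  d_eq : ∀ y z, dTwo γ y z = S.Ω.three y z
  d_eq' : ∀ y z, dTwo γ' y z = S.three y z
  flat_bijective : Function.Bijective fun a => S.Ω.symb a - γ (𝒜.anchor a)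

/-- Equivalence of homotopy holomorphic `1`-shifted symplectic quotients `[X/A]` and `[X/B]` under
`X`, with isotropic structures `γ₁' + i γ₁` and `γ₂' + i γ₂`.  It consists of an isomorphism `φ` of
Lie algebroids, a homotopy `k` from `φ_*(ℐ, 𝒬)` to the second homotopy holomorphic structure, which
induces the isomorphism `(y, a) ↦ (y, φ a + k y)` of complex Lie algebroids `L`, and a
homotopy `μ = λ' + i λ` between the closed two-forms of degree `1`: the second form is the
transport of the first one plus `(d + δ)μ`, and `γ₂' + i γ₂ = γ₁' + i γ₁ + μ`.  (On `L` one has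
`i y = ρ a - r y`, whence the formula for `bil`.) -/
def Equivalent (𝒜 : Algebroid R A) (S : HolSympData R A) (γ₁ γ₁' : Bil R)
    (ℬ : Algebroid R B) (T : HolSympData R B) (γ₂ γ₂' : Bil R) : Prop :=
  ∃ (φ : A ≃ₗ[R] B) (k : VF R →ₗ[R] B) (lam lam' : Bil R),
    (∀ a, ℬ.anchor (φ a) = 𝒜.anchor a) ∧
    (∀ a b, φ (𝒜.bracket a b) = ℬ.bracket (φ a) (φ b)) ∧
    T.hol = (S.hol.map φ).gauge ℬ k ∧
    IsTwoForm lam ∧ IsTwoForm lam' ∧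
    (∀ a, T.Ω.symb (φ a) = S.Ω.symb a + lam (𝒜.anchor a)) ∧
    (∀ a y z, T.Ω.op (φ a) y z = S.Ω.op a y z + lieBil (𝒜.anchor a) lam y z) ∧
    (∀ y z, T.Ω.three y z = S.Ω.three y z + dTwo lam y z) ∧
    (∀ y, T.bil y + T.Ω.symb (k y) = S.bil y + lam' y - lam (S.hol.I₁.r y)) ∧
    (∀ y z, T.three y z = S.three y z + dTwo lam' y z) ∧
    γ₂ = γ₁ + lam ∧ γ₂' = γ₁' + lam'

end HolSymplectic

/-! ### Generalized complex structures -/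

section GenComplex

variable {R : Type*} [CommRing R] [Algebra ℝ R]

/-- The Courant bracket on `TX ⊕ T^*X`. -/
def courant (w v : VF R × Cov R) : VF R × Cov R :=
  (⁅w.1, v.1⁆, lieD w.1 v.2 - lieD v.1 w.2 - dFun ((1 / 2 : ℝ) • (v.2 w.1 - w.2 v.1)))

/-- A generalized complex structure: an endomorphism `J` of `TX ⊕ T^*X` with `J² = -1`, which
preserves the natural pairing and is integrable for the Courant bracket. -/
@[ext]
structure GenComplex (R : Type*) [CommRing R] [Algebra ℝ R] where
  J : VF R × Cov R →ₗ[R] VF R × Cov R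
  sq : ∀ w, J (J w) = -w
  orthogonal : ∀ w v, (J w).2 (J v).1 + (J v).2 (J w).1 = w.2 v.1 + v.2 w.1
  integrable : ∀ w v,
    courant (J w) (J v) - courant w v - J (courant (J w) v + courant w (J v)) = 0

namespace GenComplex

/-- The components of `J = (-I, P; Q, ᵗI)`; `It` is the lower right corner. -/
def I (J : GenComplex R) : VF R →ₗ[R] VF R :=
  -((LinearMap.fst R _ _).comp (J.J.comp (LinearMap.inl R _ _)))

def P (J : GenComplex R) : Cov R →ₗ[R] VF R :=
  (LinearMap.fst R _ _).comp (J.J.comp (LinearMap.inr R _ _))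

def Q (J : GenComplex R) : VF R →ₗ[R] Cov R :=
  (LinearMap.snd R _ _).comp (J.J.comp (LinearMap.inl R _ _))

def It (J : GenComplex R) : Cov R →ₗ[R] Cov R :=
  (LinearMap.snd R _ _).comp (J.J.comp (LinearMap.inr R _ _))

/-- The pair `(ℐ, 𝒬)` on `[X/T^*X]` induced by `J`: `ℐ₁` is given by `I` and `ᵗI`, with operator
`α ↦ (y ↦ ι_y d(ᵗI α) - ι_{I y} dα)`, and `ℐ₂ = dQ`, `𝒬₁ = Q`. -/
def inducedHol (J : GenComplex R) : HolData R (Cov R) where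
  I₁ :=
    { op := fun y α => iotaD y (J.It α) - iotaD (J.I y) α
      l := J.It
      r := J.I }
  I₂ := dTwo J.Q
  Q₁ := J.Q

/-- The pair `(ℐ, 𝒬)` together with the canonical form on `[X/T^*X]`; the homotopy data are
zero. -/
def induced (J : GenComplex R) : HolSympData R (Cov R) where
  hol := J.inducedHol
  Ω := canonicalForm R
  bil := 0
  three := 0

end GenComplex

end GenComplex

/-! ### Smooth sections of a vector bundle as a module over the smooth functions -/

section Sections

variable {E : Type*} [NormedAddCommGroup E] [NormedSpace ℝ E] {H : Type*} [TopologicalSpace H]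
  {I : ModelWithCorners ℝ E H} {X : Type*} [TopologicalSpace X] [ChartedSpace H X]
  {F : Type*} [NormedAddCommGroup F] [NormedSpace ℝ F] {V : X → Type*}
  [TopologicalSpace (Bundle.TotalSpace F V)] [∀ x, AddCommGroup (V x)] [∀ x, Module ℝ (V x)]
  [∀ x, TopologicalSpace (V x)] [FiberBundle F V] [VectorBundle ℝ F V]

instance : SMul C^∞⟮I, X; ℝ⟯ Cₛ^∞⟮I; F, V⟯ :=
  ⟨fun f s => ⟨fun x => f x • s x, f.contMDiff.smul_section s.contMDiff⟩⟩

theorem smul_section_apply (f : C^∞⟮I, X; ℝ⟯) (s : Cₛ^∞⟮I; F, V⟯) (x : X) :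
    (f • s) x = f x • s x := rfl

instance : Module C^∞⟮I, X; ℝ⟯ Cₛ^∞⟮I; F, V⟯ where
  one_smul s := by ext x; simp [smul_section_apply]
  mul_smul f g s := by ext x; simp [smul_section_apply, mul_smul]
  smul_zero f := by ext x; simp [smul_section_apply]
  smul_add f s t := by ext x; simp [smul_section_apply]
  add_smul f g s := by ext x; simp [smul_section_apply, add_smul]
  zero_smul s := by ext x; simp [smul_section_apply]

end Sections

end GCStack

end

open scoped Manifold ContDiff

noncomputable section

namespace GCStack

/-! ### Cartan calculus for derivations and one-forms. -/

section Cartan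

variable {R : Type*} [CommRing R] [Algebra ℝ R]

/-! Both directions rest on one object. For an endomorphism `𝕁` with `𝕁² = -1` on `TX ⊕ A`, the
sections `w - i 𝕁w` span `L`, so the complex Lie algebroid `L` can be replaced by the real space `TX
⊕ A` with the bracket `T = totalBracket`. If `A = T^*X` and the structure comes from `J`, then `T(w,
v) = [Jw, v] + [w, Jv]` for the Dorfman bracket, and integrability of `J` says `J T(w, v) = [Jw, Jv]
- [w, v]`. Hence `T` is `J`-bilinear, and its Jacobi identity is a combination of four Dorfman ones
(`totalBracket_jacobi`). The equations of a homotopy holomorphic structure are read off from these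
identities by evaluating on vector fields and one-forms separately
(`isHomotopyHolomorphic_of_totalBracket`).

Conversely, subtracting the Lagrangian structure `γ' + iγ` from the symbol of the holomorphic form
leaves a map `L → T^*X ⊗ ℂ` whose real part on `w - i 𝕁w` is the `T^*X` component of an isomorphism
`TX ⊕ A ≃ TX ⊕ T^*X` (`shear`). Transporting `𝕁` along it gives `J`: skewness of the form makes `J`
orthogonal, and closedness together with `totalBracket_endo_add` identifies `T` with `[Jw, v] + [w,
Jv]` (`shear_totalBracket`) and makes `J` integrable. The components of the shear are the
isomorphism `φ` and the homotopy `k` of the equivalence.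

Uniqueness holds because the normal form has zero Lagrangian structure, identity symbol and zero
homotopy data; these force `μ`, then `φ`, then `k`, hence `J`. The argument is algebraic and works
over any commutative `ℝ`-algebra; the manifold enters only in the final statement. -/

@[simp] theorem dFun_apply (f : R) (y : VF R) : dFun f y = y f := rfl

@[simp] theorem lieD_apply (y : VF R) (α : Cov R) (z : VF R) :
    lieD y α z = y (α z) - α ⁅y, z⁆ := rfl

theorem dOne_apply (α : Cov R) (y : VF R) : dOne α y = iotaD y α := rfl

theorem dFun_add (f g : R) : dFun (f + g) = dFun f + dFun g := by ext; simp
theorem dFun_sub (f g : R) : dFun (f - g) = dFun f - dFun g := by ext; simp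
theorem dFun_neg (f : R) : dFun (-f) = -dFun f := by ext; simp
theorem dFun_zero : dFun (0 : R) = 0 := by ext; simp

theorem lieD_add (y : VF R) (α β : Cov R) : lieD y (α + β) = lieD y α + lieD y β := by
  ext; simp; ring
theorem lieD_sub (y : VF R) (α β : Cov R) : lieD y (α - β) = lieD y α - lieD y β := by
  ext; simp; ring
theorem lieD_neg (y : VF R) (α : Cov R) : lieD y (-α) = -lieD y α := by ext; simp; ring
theorem lieD_zero (y : VF R) : lieD y (0 : Cov R) = 0 := by ext; simp
theorem add_lieD (y z : VF R) (α : Cov R) : lieD (y + z) α = lieD y α + lieD z α := by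
  ext; simp; ring
theorem neg_lieD (y : VF R) (α : Cov R) : lieD (-y) α = -lieD y α := by
  ext
  simp only [lieD_apply, Derivation.neg_apply, neg_lie, map_neg, LinearMap.neg_apply]
  ring
theorem zero_lieD (α : Cov R) : lieD 0 α = 0 := by ext; simp

theorem lieD_dFun (y : VF R) (f : R) : lieD y (dFun f) = dFun (y f) := by
  ext z; simp [Derivation.commutator_apply]

theorem lieD_lie (y z : VF R) (α : Cov R) :
    lieD ⁅y, z⁆ α = lieD y (lieD z α) - lieD z (lieD y α) := by
  ext x
  simp only [lieD_apply, Derivation.commutator_apply, LinearMap.sub_apply, map_sub, lie_lie]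
  ring

theorem iotaD_add (y : VF R) (α β : Cov R) : iotaD y (α + β) = iotaD y α + iotaD y β := by
  simp only [iotaD, lieD_add, LinearMap.add_apply, dFun_add]; abel
theorem iotaD_sub (y : VF R) (α β : Cov R) : iotaD y (α - β) = iotaD y α - iotaD y β := by
  simp only [iotaD, lieD_sub, LinearMap.sub_apply, dFun_sub]; abel
theorem iotaD_neg (y : VF R) (α : Cov R) : iotaD y (-α) = -iotaD y α := by
  simp only [iotaD, lieD_neg, LinearMap.neg_apply, dFun_neg]; abel
theorem add_iotaD (y z : VF R) (α : Cov R) : iotaD (y + z) α = iotaD y α + iotaD z α :=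
  (dOne α).map_add y z
theorem neg_iotaD (y : VF R) (α : Cov R) : iotaD (-y) α = -iotaD y α := (dOne α).map_neg y
theorem iotaD_zero (y : VF R) : iotaD y (0 : Cov R) = 0 := by
  simp [iotaD, lieD_zero, dFun_zero]
theorem zero_iotaD (α : Cov R) : iotaD 0 α = 0 := (dOne α).map_zero

theorem iotaD_dFun (y : VF R) (f : R) : iotaD y (dFun f) = 0 := by
  simp [iotaD, lieD_dFun]

theorem lieD_smul (y : VF R) (f : R) (α : Cov R) :
    lieD y (f • α) = f • lieD y α + y f • α := by
  ext z; simp; ring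

theorem smul_lie_vf (f : R) (y z : VF R) : ⁅f • y, z⁆ = f • ⁅y, z⁆ - z f • y := by
  ext g
  simp [Derivation.commutator_apply]
  ring

theorem smul_lieD (f : R) (y : VF R) (α : Cov R) :
    lieD (f • y) α = f • lieD y α + α y • dFun f := by
  ext z; simp [smul_lie_vf]; ring

theorem iotaD_apply (y z : VF R) (α : Cov R) :
    iotaD y α z = y (α z) - z (α y) - α ⁅y, z⁆ := by
  simp [iotaD]; ring

theorem iotaD_apply_self (y : VF R) (α : Cov R) : iotaD y α y = 0 := by
  simp [iotaD_apply]

/-- A vector field is determined by the values of one-forms on it. -/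
theorem vf_ext {y z : VF R} (h : ∀ α : Cov R, α y = α z) : y = z := by
  ext f; exact h (dFun f)

/-- The scalar `1/2` of the `ℝ`-algebra `R` acts on `M`. -/
theorem two_nsmul_cancel {M : Type*} [AddCommGroup M] [Module R M] {a b : M}
    (h : (2 : ℕ) • a = (2 : ℕ) • b) : a = b := by
  have key : ∀ c : M, (algebraMap ℝ R (1 / 2)) • ((2 : ℕ) • c) = c := by
    intro c
    rw [← Nat.cast_smul_eq_nsmul R, smul_smul]
    have : algebraMap ℝ R (1 / 2) * ((2 : ℕ) : R) = 1 := by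
      rw [← map_natCast (algebraMap ℝ R), ← map_mul]; norm_num
    rw [this, one_smul]
  rw [← key a, h, key]

/-- `dβ(y, z) = L_y β(z) - ι_z dβ(y) - β([y, z])`. -/
theorem dTwo_eq {β : Bil R} (y z : VF R) :
    dTwo β y z = lieD y (β z) - iotaD z (β y) - β ⁅y, z⁆ := by
  simp only [dTwo, iotaD]; abel

theorem dTwo_neg (β : Bil R) (y z : VF R) : dTwo (-β) y z = -dTwo β y z := by
  simp only [dTwo_eq, LinearMap.neg_apply, lieD_neg, iotaD_neg]; abel

theorem dTwo_zero (y z : VF R) : dTwo (0 : Bil R) y z = 0 := by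
  simp [dTwo_eq, lieD_zero, iotaD_zero]

/-! ### The Dorfman bracket and its relation to the Courant bracket. -/

/-- The Dorfman bracket on `TX ⊕ T^*X`. -/
def dorfman (w v : VF R × Cov R) : VF R × Cov R :=
  (⁅w.1, v.1⁆, lieD w.1 v.2 - iotaD v.1 w.2)

/-- The natural pairing on `TX ⊕ T^*X`. -/
def pairing (w v : VF R × Cov R) : R := w.2 v.1 + v.2 w.1

theorem dorfman_add (w v u : VF R × Cov R) :
    dorfman w (v + u) = dorfman w v + dorfman w u := by
  simp only [dorfman, Prod.fst_add, Prod.snd_add, lie_add, lieD_add, add_iotaD, Prod.mk_add_mk,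
    Prod.mk.injEq, true_and]
  abel
theorem add_dorfman (w v u : VF R × Cov R) :
    dorfman (w + v) u = dorfman w u + dorfman v u := by
  simp only [dorfman, Prod.fst_add, Prod.snd_add, add_lie, add_lieD, iotaD_add, Prod.mk_add_mk,
    Prod.mk.injEq, true_and]
  abel
theorem dorfman_neg (w v : VF R × Cov R) : dorfman w (-v) = -dorfman w v := by
  simp only [dorfman, Prod.fst_neg, Prod.snd_neg, lie_neg, lieD_neg, neg_iotaD, Prod.neg_mk,
    Prod.mk.injEq, true_and]
  abel
theorem neg_dorfman (w v : VF R × Cov R) : dorfman (-w) v = -dorfman w v := by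
  simp only [dorfman, Prod.fst_neg, Prod.snd_neg, neg_lie, neg_lieD, iotaD_neg, Prod.neg_mk,
    Prod.mk.injEq, true_and]
  abel
theorem dorfman_sub (w v u : VF R × Cov R) :
    dorfman w (v - u) = dorfman w v - dorfman w u := by
  rw [sub_eq_add_neg, dorfman_add, dorfman_neg, sub_eq_add_neg]
theorem sub_dorfman (w v u : VF R × Cov R) :
    dorfman (w - v) u = dorfman w u - dorfman v u := by
  rw [sub_eq_add_neg, add_dorfman, neg_dorfman, sub_eq_add_neg]

/-- Follows from `[L_y, L_z] = L_{[y,z]}` and `L_y d = d L_y`. This Leibniz form of Jacobi holds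
exactly, which is why the Dorfman bracket is used in place of the skew Courant bracket. -/
theorem dorfman_jacobi (w v u : VF R × Cov R) :
    dorfman w (dorfman v u) = dorfman (dorfman w v) u + dorfman v (dorfman w u) := by
  ext1
  · simp only [dorfman, Prod.fst_add]
    rw [← leibniz_lie]
  · simp only [dorfman, Prod.snd_add, iotaD, lieD_sub, lieD_lie, dFun_sub, lieD_dFun, lieD_apply,
      LinearMap.sub_apply, dFun_apply]
    abel

theorem courant_eq (w v : VF R × Cov R) :
    courant w v = dorfman w v - (0, dFun ((1 / 2 : ℝ) • pairing w v)) := by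
  ext1
  · simp [courant, dorfman]
  · have h : dFun (w.2 v.1) = dFun ((1 / 2 : ℝ) • (w.2 v.1 + v.2 w.1)) -
        dFun ((1 / 2 : ℝ) • (v.2 w.1 - w.2 v.1)) := by
      rw [← dFun_sub, ← smul_sub]
      congr 1
      rw [show w.2 v.1 + v.2 w.1 - (v.2 w.1 - w.2 v.1) = (2 : ℝ) • w.2 v.1 by
        rw [two_smul]; ring, smul_smul]
      norm_num
    simp only [courant, dorfman, iotaD, pairing, Prod.snd_sub, h]
    abel

end Cartan

/-! ### From a `𝕁`-bilinear Lie bracket on `TX ⊕ A` to a homotopy holomorphic structure. -/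

section TotalBracket

variable {R A : Type*} [CommRing R] [Algebra ℝ R] [AddCommGroup A] [Module R A]
  {𝒜 : Algebroid R A}

namespace Algebroid.IsLie

theorem zero_left (h : 𝒜.IsLie) (b : A) : 𝒜.bracket 0 b = 0 := by simpa using h.add_left 0 0 b
theorem zero_right (h : 𝒜.IsLie) (b : A) : 𝒜.bracket b 0 = 0 := by simpa using h.add_right b 0 0
theorem neg_left (h : 𝒜.IsLie) (a b : A) : 𝒜.bracket (-a) b = -𝒜.bracket a b :=
  eq_neg_of_add_eq_zero_left (by rw [← h.add_left, neg_add_cancel, h.zero_left])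
theorem neg_right (h : 𝒜.IsLie) (a b : A) : 𝒜.bracket a (-b) = -𝒜.bracket a b :=
  eq_neg_of_add_eq_zero_left (by rw [← h.add_right, neg_add_cancel, h.zero_right])
theorem skew (h : 𝒜.IsLie) (a b : A) : 𝒜.bracket a b = -𝒜.bracket b a := by
  have := h.self (a + b)
  rw [h.add_left, h.add_right, h.add_right, h.self, h.self, zero_add, add_zero] at this
  exact eq_neg_of_add_eq_zero_left this

end Algebroid.IsLie

namespace EndForm.IsForm

variable {K : EndForm R A}

theorem zero_left (h : K.IsForm) (a : A) : K.op 0 a = 0 := by simpa using h.add_left 0 0 a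
theorem zero_right (h : K.IsForm) (y : VF R) : K.op y 0 = 0 := by simpa using h.add_right y 0 0
theorem neg_left (h : K.IsForm) (y : VF R) (a : A) : K.op (-y) a = -K.op y a :=
  eq_neg_of_add_eq_zero_left (by rw [← h.add_left, neg_add_cancel, h.zero_left])
theorem neg_right (h : K.IsForm) (y : VF R) (a : A) : K.op y (-a) = -K.op y a :=
  eq_neg_of_add_eq_zero_left (by rw [← h.add_right, neg_add_cancel, h.zero_right])

end EndForm.IsForm

namespace IsTwoFormValued

variable {h : VF R → VF R → A}

theorem zero_left (hh : IsTwoFormValued h) (y : VF R) : h 0 y = 0 := by simpa using hh.add_left 0 0 y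
theorem neg_left (hh : IsTwoFormValued h) (y z : VF R) : h (-y) z = -h y z :=
  eq_neg_of_add_eq_zero_left (by rw [← hh.add_left, neg_add_cancel, hh.zero_left])

theorem zero_right (_ : IsTwoFormValued h)
    (hadd : ∀ x y z, h x (y + z) = h x y + h x z) (y : VF R) : h y 0 = 0 := by simpa using hadd y 0 0
theorem neg_right (hh : IsTwoFormValued h)
    (hadd : ∀ x y z, h x (y + z) = h x y + h x z) (y z : VF R) : h y (-z) = -h y z :=
  eq_neg_of_add_eq_zero_left (by rw [← hadd, neg_add_cancel, hh.zero_right hadd])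
theorem skew (hh : IsTwoFormValued h)
    (hadd : ∀ x y z, h x (y + z) = h x y + h x z) (y z : VF R) : h y z = -h z y := by
  have := hh.self (y + z)
  rw [hh.add_left, hadd, hadd, hh.self, hh.self, zero_add, add_zero] at this
  exact eq_neg_of_add_eq_zero_left this

end IsTwoFormValued

/-- The bracket `(w, v) ↦ [𝕁 w, v] + [w, 𝕁 v]` on `TX ⊕ A`; on `L` it is `2i` times the bracket of
the complex Lie algebroid `L`. -/
def HolData.totalBracket (𝒜 : Algebroid R A) (S : HolData R A) (w v : VF R × A) : VF R × A :=
  (⁅(S.endo 𝒜 w).1, v.1⁆ + ⁅w.1, (S.endo 𝒜 v).1⁆, S.bracketL 𝒜 w v)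

/-- A homotopy holomorphic structure amounts to `𝕁² = -1` and a `𝕁`-bilinear bracket on `TX ⊕ A`
satisfying the Jacobi identity. -/
theorem HolData.isHomotopyHolomorphic_of_totalBracket {S : HolData R A} (lie : 𝒜.IsLie)
    (form₁ : S.I₁.IsForm) (form₂ : IsTwoFormValued S.I₂)
    (hadd : ∀ x y z, S.I₂ x (y + z) = S.I₂ x y + S.I₂ x z)
    (sq : ∀ w, S.endo 𝒜 (S.endo 𝒜 w) = -w)
    (endo_left : ∀ w v, S.totalBracket 𝒜 (S.endo 𝒜 w) v = S.endo 𝒜 (S.totalBracket 𝒜 w v))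
    (endo_right : ∀ w v, S.totalBracket 𝒜 w (S.endo 𝒜 v) = S.endo 𝒜 (S.totalBracket 𝒜 w v))
    (jacobi : ∀ w v u, S.totalBracket 𝒜 w (S.totalBracket 𝒜 v u) =
      S.totalBracket 𝒜 (S.totalBracket 𝒜 w v) u + S.totalBracket 𝒜 v (S.totalBracket 𝒜 w u)) :
    S.IsHomotopyHolomorphic 𝒜 := by
  have z1 := form₁.zero_left
  have z2 := form₁.zero_right
  have z3 := form₂.zero_left
  have z4 := form₂.zero_right hadd
  have z5 := lie.zero_left
  have z6 := lie.zero_right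
  have n1 := form₁.neg_left
  have n2 := form₁.neg_right
  have n3 := form₂.neg_left
  have n4 := form₂.neg_right hadd
  have sqy (y : VF R) := sq (y, 0)
  have sqa (a : A) := sq (0, a)
  simp only [endo, map_zero, neg_zero, zero_add, add_zero, map_neg, neg_neg, Prod.neg_mk,
    Prod.mk.injEq] at sqy sqa
  -- Each identity is now tested on pure vector fields `(y, 0)` and pure sections `(0, a)`; the
  -- resulting components are the structure equations up to signs and skew-symmetry.
  have lya (y : VF R) (a : A) := endo_left (y, 0) (0, a)
  have rya (y : VF R) (a : A) := endo_right (y, 0) (0, a)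
  have lab (a b : A) := endo_left (0, a) (0, b)
  have rab (a b : A) := endo_right (0, a) (0, b)
  have lyz (y z : VF R) := endo_left (y, 0) (z, 0)
  have ryz (y z : VF R) := endo_right (y, 0) (z, 0)
  have jya (y : VF R) (a b : A) := congrArg Prod.snd (jacobi (y, 0) (0, a) (0, b))
  have jyz (y z : VF R) (a : A) := congrArg Prod.snd (jacobi (y, 0) (z, 0) (0, a))
  have jxyz (x y z : VF R) := congrArg Prod.snd (jacobi (x, 0) (y, 0) (z, 0))
  simp only [totalBracket, endo, bracketL, map_zero, neg_zero, zero_add, add_zero, map_add,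
    map_neg, neg_neg, neg_add_rev, Prod.mk_add_mk, zero_lie, lie_zero, z1, z2, z3, z4, z5, z6, n1,
    n3, n4, form₁.add_left, form₁.add_right, form₂.add_left, hadd, lie.add_left,
    sub_zero, zero_sub, neg_lie, lie_neg, add_lie, lie_add,
    Prod.mk.injEq] at lya rya lab rab lyz ryz jya jyz jxyz
  have sv (y z : VF R) : ⁅y, z⁆ = -⁅z, y⁆ := (lie_skew y z).symm
  have sr (y z : VF R) : S.I₁.r ⁅y, z⁆ = -S.I₁.r ⁅z, y⁆ := by rw [sv, map_neg]
  have sQ (y z : VF R) : S.Q₁ ⁅y, z⁆ = -S.Q₁ ⁅z, y⁆ := by rw [sv, map_neg]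
  have sop (y z : VF R) (a : A) : S.I₁.op ⁅y, z⁆ a = -S.I₁.op ⁅z, y⁆ a := by rw [sv, n1]
  have sI (y z x : VF R) : S.I₂ y ⁅z, x⁆ = -S.I₂ y ⁅x, z⁆ := by rw [sv, n4]
  have sI₂ := form₂.skew hadd
  have jQ (x y z : VF R) : S.Q₁ ⁅⁅x, y⁆, z⁆ = S.Q₁ ⁅x, ⁅y, z⁆⁆ - S.Q₁ ⁅y, ⁅x, z⁆⁆ := by
    rw [lie_lie, map_sub]
  refine
    { form₁ := form₁
      form₂ := form₂
      comm := fun y => ?_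
      mc_one := ⟨fun a => ?_, fun y a => ?_, fun a b => (rab a b).2.symm, fun y a b => ?_⟩
      mc_two_base := fun y z => ?_
      mc_two_symb := fun a z => ?_
      mc_two_op := fun a y z => ?_
      mc_three := fun x y z => ?_
      sq_one_r := fun y => ?_
      sq_one_l := fun a => ?_
      sq_one_op := fun y a => ?_
      sq_two := fun y z => ?_ }
  · linear_combination (norm := abel) (sqy y).2
  · linear_combination (norm := abel) (sqa a).1
  · linear_combination (norm := abel) -(lya y a).1 - sv (S.I₁.r y) (𝒜.anchor a)
      + sr y (𝒜.anchor a)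
  · linear_combination (norm := abel) jya y a b + lie.skew (S.I₁.op y a) b
      + sop y (𝒜.anchor a) b - sop y (𝒜.anchor b) a
  · have h1 : ⁅S.I₁.r (S.I₁.r y) + 𝒜.anchor (S.Q₁ y), z⁆ = -⁅y, z⁆ := by
      rw [(sqy y).1, neg_lie]
    rw [add_lie] at h1
    simp only [deltaTwo, EndForm.torsion]
    linear_combination (norm := abel) (lyz y z).1 - h1 + (sqy ⁅y, z⁆).1
  · simp only [deltaTwo, EndForm.torsion]
    linear_combination (norm := abel) (rya z a).2 - sI₂ (𝒜.anchor a) z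
  · simp only [deltaTwo, EndForm.torsion]
    have h1 := sI₂ ⁅𝒜.anchor a, y⁆ z
    have h2 := sI z (𝒜.anchor a) y
    linear_combination (norm := abel) -jyz y z a - (lya ⁅y, z⁆ a).2 - lie.skew a (S.I₂ y z)
      + h1 - h2 + sI y (𝒜.anchor a) z - jQ y z (𝒜.anchor a)
  · have hD : S.I₁.op y (S.I₂ x z) = -S.I₁.op y (S.I₂ z x) := by rw [sI₂, n2]
    have hDQ : S.I₁.op y (S.Q₁ ⁅x, z⁆) = -S.I₁.op y (S.Q₁ ⁅z, x⁆) := by rw [sQ, n2]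
    have h1 : S.I₂ ⁅S.I₁.r x, z⁆ y = -S.I₂ ⁅z, S.I₁.r x⁆ y := by rw [sv, n3]
    have h2 : S.I₂ ⁅x, S.I₁.r z⁆ y = -S.I₂ ⁅S.I₁.r z, x⁆ y := by rw [sv, n3]
    -- The terms `l(Q[[x, y], z])` cancel by the Jacobi identity of vector fields, and the remaining
    -- `Q`-terms by the Jacobi identity with `r` applied to one argument at a time.
    have jV (p q r : VF R) : ⁅⁅p, q⁆, r⁆ + ⁅⁅q, r⁆, p⁆ + ⁅⁅r, p⁆, q⁆ = 0 := by
      ext f; simp only [Derivation.commutator_apply, Derivation.add_apply, map_sub,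
        Derivation.zero_apply]; ring
    have hlQ := congrArg (fun v => S.I₁.l (S.Q₁ v)) (jV x y z)
    have hQ : S.Q₁ (⁅⁅x, y⁆, S.I₁.r z⁆ + ⁅⁅y, z⁆, S.I₁.r x⁆ + ⁅⁅z, x⁆, S.I₁.r y⁆
        - ⁅x, ⁅S.I₁.r y, z⁆⁆ - ⁅x, ⁅y, S.I₁.r z⁆⁆ + ⁅⁅S.I₁.r x, y⁆, z⁆ + ⁅⁅x, S.I₁.r y⁆, z⁆
        + ⁅y, ⁅S.I₁.r x, z⁆⁆ + ⁅y, ⁅x, S.I₁.r z⁆⁆) = 0 := by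
      convert S.Q₁.map_zero
      ext f; simp only [Derivation.commutator_apply, Derivation.add_apply, Derivation.sub_apply,
        map_sub, Derivation.zero_apply]; ring
    simp only [map_add, map_sub, map_zero] at hlQ hQ
    simp only [EndForm.fnTwo, EndForm.fnTwoAux]
    linear_combination (norm := abel) -jxyz x y z - (lyz ⁅x, y⁆ z).2 - (lyz ⁅y, z⁆ x).2
      - (lyz ⁅z, x⁆ y).2 - hlQ + hQ - hD - hDQ - sI₂ x ⁅S.I₁.r y, z⁆ - sI₂ x ⁅y, S.I₁.r z⁆
      + sI₂ y ⁅S.I₁.r x, z⁆ + sI₂ y ⁅x, S.I₁.r z⁆ - h1 - h2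
  · simp only [deltaOne, EndForm.sq, LinearMap.comp_apply]
    linear_combination (norm := abel) (sqy y).1
  · simp only [deltaOne, EndForm.sq, LinearMap.comp_apply]
    linear_combination (norm := abel) (sqa a).2
  · simp only [deltaOne, EndForm.sq]
    linear_combination (norm := abel) -(lya y a).2 + lie.skew a (S.Q₁ y) - sQ (𝒜.anchor a) y
  · simp only [EndForm.fnOne]
    -- This equation only records the sum of left and right `𝕁`-linearity on two vector fields.
    linear_combination (norm := abel) -(lyz y z).2 - (ryz y z).2 - (sqy ⁅y, z⁆).2

end TotalBracket

/-! ### The structures induced by a generalized complex structure. -/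

section GenComplexInduced

variable {R : Type*} [CommRing R] [Algebra ℝ R]

theorem eq_zero_of_eq_neg {f : R} (h : f = -f) : f = 0 := by
  refine two_nsmul_cancel (R := R) ?_
  rw [two_nsmul, smul_zero]
  linear_combination h

theorem lieBil_dOne (x : VF R) (α : Cov R) (y z : VF R) :
    lieBil x (dOne α) y z = dOne (lieD x α) y z := by
  simp only [lieBil, dOne_apply, iotaD_apply, lieD_apply, map_sub, Derivation.commutator_apply,
    leibniz_lie x y z, map_add]
  ring

/-- The two one-forms differ by the exact form `d(α x)`. -/
theorem dOne_iotaD (x : VF R) (α : Cov R) : dOne (iotaD x α) = dOne (lieD x α) := by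
  refine LinearMap.ext fun y => ?_
  rw [dOne_apply, dOne_apply, iotaD.eq_1 x, iotaD_sub, iotaD_dFun, sub_zero]

theorem dTwo_dOne (α : Cov R) (y z : VF R) : dTwo (dOne α) y z = 0 := by
  simp only [dTwo, dOne_apply, iotaD, lieD_sub, lieD_lie, lieD_dFun, LinearMap.sub_apply,
    lieD_apply, dFun_apply, dFun_sub]
  abel

/-- Integrability for the Courant bracket is integrability for the Dorfman bracket. -/
theorem courant_integrable_iff (J : VF R × Cov R →ₗ[R] VF R × Cov R)
    (sq : ∀ w, J (J w) = -w) (orth : ∀ w v, pairing (J w) (J v) = pairing w v)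
    (w v : VF R × Cov R) :
    courant (J w) (J v) - courant w v - J (courant (J w) v + courant w (J v)) = 0 ↔
      dorfman (J w) (J v) - dorfman w v = J (dorfman (J w) v + dorfman w (J v)) := by
  -- Orthogonality and `J² = -1` make `J` skew, so the exact terms separating Courant from Dorfman
  -- cancel in pairs.
  have skew : pairing (J w) v + pairing w (J v) = 0 := by
    have h := orth (J w) v
    rw [sq] at h
    rw [← h]
    simp [pairing]
    ring
  have h0 : ((0, dFun ((1 / 2 : ℝ) • pairing (J w) v)) : VF R × Cov R) +
      (0, dFun ((1 / 2 : ℝ) • pairing w (J v))) = 0 := by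
    rw [Prod.mk_add_mk, ← dFun_add, ← smul_add, skew, smul_zero, dFun_zero, add_zero]
    rfl
  have h1 : courant (J w) v + courant w (J v) = dorfman (J w) v + dorfman w (J v) := by
    rw [courant_eq, courant_eq]
    linear_combination (norm := abel) -h0
  have h2 : courant (J w) (J v) - courant w v = dorfman (J w) (J v) - dorfman w v := by
    rw [courant_eq, courant_eq, orth]
    abel
  rw [h1, h2, sub_eq_zero]

namespace GenComplex

variable (J : GenComplex R)

theorem J_apply (w : VF R × Cov R) :
    J.J w = (-J.I w.1 + J.P w.2, J.Q w.1 + J.It w.2) := by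
  have h : J.J w = J.J (w.1, 0) + J.J (0, w.2) := by rw [← map_add]; simp
  rw [h]
  ext1 <;> simp [I, P, Q, It]

theorem pairing_J_J (w v : VF R × Cov R) : pairing (J.J w) (J.J v) = pairing w v :=
  J.orthogonal w v

theorem pairing_J (w v : VF R × Cov R) : pairing (J.J w) v = -pairing w (J.J v) := by
  have h := J.pairing_J_J (J.J w) v
  rw [J.sq] at h
  rw [← h]
  simp [pairing]
  ring

theorem dorfman_integrable (w v : VF R × Cov R) :
    dorfman (J.J w) (J.J v) - dorfman w v = J.J (dorfman (J.J w) v + dorfman w (J.J v)) :=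
  (courant_integrable_iff J.J J.sq J.pairing_J_J w v).1 (J.integrable w v)

theorem It_apply (α : Cov R) (y : VF R) : J.It α y = α (J.I y) := by
  have h := J.pairing_J (0, α) (y, 0)
  simpa [J_apply, pairing] using h

theorem P_skew (α β : Cov R) : β (J.P α) = -α (J.P β) := by
  have h := J.pairing_J (0, α) (0, β)
  simpa [J_apply, pairing] using h

theorem Q_skew (y z : VF R) : J.Q y z = -J.Q z y := by
  have h := J.pairing_J (y, 0) (z, 0)
  simpa [J_apply, pairing] using h

theorem Q_isTwoForm : IsTwoForm J.Q := fun y => eq_zero_of_eq_neg (J.Q_skew y y)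

theorem endo_inducedHol (w : VF R × Cov R) :
    J.inducedHol.endo (poissonAlgebroid J.P) w = J.J w := by
  rw [J_apply]; rfl

/-- The exact parts of the two contractions agree, since `ᵗI α` on `y` is `α` on `I y`; what is left
are Lie derivatives, which compare directly with the Dorfman bracket. -/
theorem op_inducedHol (y : VF R) (α : Cov R) :
    J.inducedHol.I₁.op y α = lieD y (J.It α) - lieD (J.I y) α := by
  simp only [inducedHol, iotaD, It_apply]
  abel

/-- The reason for the formulas defining the induced data: two one-forms contribute the Poisson
bracket, a mixed pair the operator of `ℐ₁`, and two vector fields `Q[y, z] + dQ(y, z) = L_y Qz - ι_z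
dQy`. -/
theorem totalBracket_inducedHol (w v : VF R × Cov R) :
    J.inducedHol.totalBracket (poissonAlgebroid J.P) w v =
      dorfman (J.J w) v + dorfman w (J.J v) := by
  ext1
  · simp [HolData.totalBracket, endo_inducedHol, dorfman]
  · simp only [HolData.totalBracket, HolData.bracketL, op_inducedHol, dorfman, Prod.snd_add,
      J_apply, add_lieD, neg_lieD, lieD_add, iotaD_add, add_iotaD, neg_iotaD]
    simp only [inducedHol, poissonAlgebroid, dTwo_eq, iotaD, It_apply]
    abel

theorem isPoisson : IsPoisson J.P where
  skew := J.P_skew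
  jacobi f g h := by
    -- On exact one-forms integrability reduces to `[P df, P dg] = P d((P df) g)`, as `L_y` commutes
    -- with `d` and `ddf = 0`.
    have key := congrArg Prod.fst (J.dorfman_integrable (0, dFun f) (0, dFun g))
    simp only [J_apply, dorfman, map_zero, neg_zero, zero_add, Prod.mk_add_mk, Prod.fst_sub,
      lie_zero, zero_lie, sub_zero, add_zero, iotaD_dFun, zero_iotaD, zero_lieD, lieD_dFun]
      at key
    have := congrArg (fun y : VF R => y h) key
    simp only [Derivation.commutator_apply] at this
    rw [← this]; ring

theorem P_bracket (α β : Cov R) :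
    J.P ((poissonAlgebroid J.P).bracket α β) = ⁅J.P α, J.P β⁆ := by
  have key := congrArg Prod.fst (J.dorfman_integrable (0, α) (0, β))
  simp only [J_apply, dorfman, map_zero, neg_zero, zero_add, Prod.mk_add_mk, Prod.fst_sub,
      lie_zero, zero_lie, sub_zero, add_zero, zero_iotaD, zero_lieD, zero_sub] at key
  rw [key, ← sub_eq_add_neg]
  rfl

/-- Integrability turns `J` of an inner bracket into `[Jv, Ju] - [v, u]`. Every term is then an
iterated Dorfman bracket with an even number of `J`'s, and four Dorfman Jacobi identities sum to the
claim. -/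
theorem totalBracket_jacobi (w v u : VF R × Cov R) :
    J.inducedHol.totalBracket (poissonAlgebroid J.P) w
        (J.inducedHol.totalBracket (poissonAlgebroid J.P) v u) =
      J.inducedHol.totalBracket (poissonAlgebroid J.P)
        (J.inducedHol.totalBracket (poissonAlgebroid J.P) w v) u +
      J.inducedHol.totalBracket (poissonAlgebroid J.P) v
        (J.inducedHol.totalBracket (poissonAlgebroid J.P) w u) := by
  simp only [totalBracket_inducedHol, ← dorfman_integrable, dorfman_add, add_dorfman,
    dorfman_sub, sub_dorfman]
  rw [dorfman_jacobi (J.J w) (J.J v) u, dorfman_jacobi (J.J w) v (J.J u),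
    dorfman_jacobi w (J.J v) (J.J u), dorfman_jacobi w v u]
  abel

theorem poissonAlgebroid_isLie : (poissonAlgebroid J.P).IsLie where
  add_left a b c := by
    simp only [poissonAlgebroid, map_add, add_lieD, iotaD_add]; abel
  add_right a b c := by
    simp only [poissonAlgebroid, map_add, lieD_add, add_iotaD]; abel
  self a := by
    have h : a (J.P a) = 0 := eq_zero_of_eq_neg (J.P_skew a a)
    simp [poissonAlgebroid, iotaD, h, dFun_zero]
  leibniz a f b := by
    simp only [poissonAlgebroid, map_smul, lieD_smul, ← dOne_apply, smul_sub]
    abel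
  jacobi a b c := by
    -- On `0 ⊕ T^*X` the second component of the total bracket is the Poisson algebroid bracket.
    have h := congrArg Prod.snd (J.totalBracket_jacobi (0, a) (0, b) (0, c))
    simp only [totalBracket_inducedHol, J_apply, dorfman, map_zero, neg_zero, zero_add,
      Prod.mk_add_mk, lie_zero, zero_lie, sub_zero, add_zero, zero_iotaD, zero_lieD,
      zero_sub, ← sub_eq_add_neg] at h
    exact h
  anchor_bracket := J.P_bracket

theorem inducedHol_isForm : J.inducedHol.I₁.IsForm where
  add_left y z a := by simp only [op_inducedHol, map_add, add_lieD]; abel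
  smul_left f y a := by
    simp only [inducedHol, map_smul, ← dOne_apply, smul_sub]
  add_right y a b := by simp only [op_inducedHol, map_add, lieD_add]; abel
  leibniz y f a := by
    simp only [op_inducedHol, map_smul, lieD_smul, smul_sub]
    simp only [inducedHol]
    abel

theorem dTwo_Q_isTwoFormValued : IsTwoFormValued (dTwo J.Q) where
  add_left x y z := by
    simp only [dTwo_eq, add_lieD, map_add, iotaD_add, add_lie]; abel
  smul_left f y z := by
    simp only [dTwo, smul_lieD, map_smul, lieD_smul, smul_lie_vf, map_sub]
    ext x
    simp [J.Q_skew z y]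
    ring
  self y := by
    simp [dTwo, J.Q_isTwoForm y, dFun_zero]

theorem dTwo_Q_add_right (x y z : VF R) :
    dTwo J.Q x (y + z) = dTwo J.Q x y + dTwo J.Q x z := by
  simp only [dTwo_eq, lieD_add, map_add, add_iotaD, lie_add]; abel

theorem inducedHol_isHomotopyHolomorphic :
    J.inducedHol.IsHomotopyHolomorphic (poissonAlgebroid J.P) := by
  refine HolData.isHomotopyHolomorphic_of_totalBracket J.poissonAlgebroid_isLie
    J.inducedHol_isForm J.dTwo_Q_isTwoFormValued J.dTwo_Q_add_right ?_ ?_ ?_ J.totalBracket_jacobi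
  · simp [endo_inducedHol, J.sq]
  · intro w v
    simp only [endo_inducedHol, totalBracket_inducedHol, ← dorfman_integrable, J.sq, neg_dorfman]
    abel
  · intro w v
    simp only [endo_inducedHol, totalBracket_inducedHol, ← dorfman_integrable, J.sq, dorfman_neg]
    abel

theorem canonicalForm_isSymplectic :
    (canonicalForm R).IsSymplectic (poissonAlgebroid J.P) where
  closed :=
    { op_form := fun a y => iotaD_apply_self y a
      three_form := ⟨fun _ => rfl, fun _ _ => rfl⟩
      op_add := fun a b => by
        exact LinearMap.ext fun y => iotaD_add y a b
      op_smul := fun f a y z => by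
        simp [canonicalForm, dOne_apply, iotaD_apply]
        ring
      delta_op := fun a b y z => by
        change dOne (lieD (J.P a) b - iotaD (J.P b) a) y z =
          lieBil (J.P a) (dOne b) y z - lieBil (J.P b) (dOne a) y z
        rw [lieBil_dOne, lieBil_dOne, ← dOne_iotaD (J.P b) a]
        simp only [dOne_apply, iotaD_sub, LinearMap.sub_apply]
      delta_symb := fun a b => rfl
      delta_skew := fun a b => by
        change a (J.P b) + b (J.P a) = 0
        rw [J.P_skew a b]; ring
      d_op := fun a y z w => by
        simp [canonicalForm, lieTri, dTwo_dOne]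
      d_symb := fun a y z => by simp [canonicalForm]
      d_three := fun x y z w => by simp [canonicalForm, dThree] }
  nondeg :=
    { split := ⟨LinearMap.snd R _ _, fun a => rfl⟩
      exact := fun y α h => by
        -- As the symbol is the identity, the preimage must be `α`; skewness of `P` gives `Pα = y`.
        refine ⟨α, vf_ext fun a => ?_, rfl⟩
        have := h a
        change a y + α (J.P a) = 0 at this
        change a (J.P α) = a y
        rw [J.P_skew]
        linear_combination -this }

/-- A section of `L` is `w - iJw` and the symbol is the projection to `T^*X`. Skewness of the form
is then orthogonality of `J`, and its closedness on such sections needs only `J² = -1` and the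
Dorfman formula for the total bracket. -/
theorem induced_isHolSymplectic : J.induced.IsHolSymplectic (poissonAlgebroid J.P) := by
  have hu (u) (hu : J.induced.hol.InL (poissonAlgebroid J.P) u) : u.2 = -J.J u.1 := by
    rw [← J.endo_inducedHol, eq_neg_iff_add_eq_zero, add_comm, ← eq_neg_iff_add_eq_zero]
    exact hu.1
  have tau (w) : J.induced.tau w = w.2 := add_zero _
  have hB (w v) : J.induced.hol.bracketL (poissonAlgebroid J.P) w v =
      (dorfman (J.J w) v + dorfman w (J.J v)).2 := by
    rw [← totalBracket_inducedHol]; rfl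
  have hC (w v : VF R × Cov R) : lieD w.1 v.2 - iotaD v.1 w.2 = (dorfman w v).2 := rfl
  refine
    { hol := J.inducedHol_isHomotopyHolomorphic
      symplectic := J.canonicalForm_isSymplectic
      three_form := ⟨fun _ => rfl, fun _ _ => rfl⟩
      three_closed := fun x y z w => by simp [induced, dThree]
      skew_re := fun u v h h' => ?_
      skew_im := fun u v h h' => ?_
      bracket_re := fun u v h h' => ?_
      bracket_im := fun u v h h' => ?_ }
  · simp only [reExt, tau, hu u h, hu v h']
    have := J.pairing_J_J u.1 v.1
    simp only [pairing] at this
    simp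
    linear_combination -this
  · simp only [imExt, tau, hu u h, hu v h']
    have := J.pairing_J u.1 v.1
    simp only [pairing] at this
    simp
    linear_combination -this
  · simp only [reExt, imExt, tau, hB, hC, hu u h, hu v h', map_neg, J.sq, neg_dorfman, dorfman_neg]
    simp [induced, canonicalForm]
    abel
  · simp only [reExt, imExt, tau, hB, hC, hu u h, hu v h', map_neg, J.sq, neg_dorfman, dorfman_neg]
    simp [induced, canonicalForm]
    abel

theorem induced_isLagrangian : J.induced.IsLagrangian (poissonAlgebroid J.P) 0 0 where
  form _ := rfl
  form' _ := rfl
  d_eq := dTwo_zero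
  d_eq' := dTwo_zero
  flat_bijective := by
    convert Function.bijective_id using 1
    ext1 a
    simp [induced, canonicalForm]

end GenComplex

end GenComplexInduced

/-! ### Consequences of the homotopy holomorphic equations on `TX ⊕ A`. -/

section Reconstruction

variable {R A : Type*} [CommRing R] [Algebra ℝ R] [AddCommGroup A] [Module R A]
  {𝒜 : Algebroid R A}

/-- The endomorphism `𝕁` of `TX ⊕ A` as a linear map. -/
def HolData.endoLin (𝒜 : Algebroid R A) (S : HolData R A) : VF R × A →ₗ[R] VF R × A where
  toFun := S.endo 𝒜
  map_add' w v := by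
    ext1 <;> simp only [HolData.endo, Prod.fst_add, Prod.snd_add, map_add] <;> abel
  map_smul' f w := by
    ext1 <;> simp [HolData.endo]

theorem HolData.endoLin_apply (S : HolData R A) (w : VF R × A) :
    S.endoLin 𝒜 w = S.endo 𝒜 w := rfl

theorem HolData.IsHomotopyHolomorphic.endo_endo {S : HolData R A}
    (h : S.IsHomotopyHolomorphic 𝒜) (w : VF R × A) : S.endo 𝒜 (S.endo 𝒜 w) = -w := by
  have h1 := h.sq_one_r w.1
  have h2 := h.sq_one_l w.2
  have h3 := h.comm w.1
  have h4 := h.mc_one.anchor_l w.2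
  simp only [deltaOne, EndForm.sq, LinearMap.comp_apply] at h1 h2
  ext1
  · simp only [HolData.endo, map_add, map_neg, Prod.fst_neg]
    linear_combination (norm := abel) h1 + h4
  · simp only [HolData.endo, map_add, map_neg, Prod.snd_neg]
    linear_combination (norm := abel) h2 + h3

/-- These are the sections `w - i𝕁w`; testing the complex equations on them yields real equations
valid for all `w` in `TX ⊕ A`. -/
theorem HolData.inL_graph {S : HolData R A} (h : S.IsHomotopyHolomorphic 𝒜) (w : VF R × A) :
    S.InL 𝒜 (w, -S.endo 𝒜 w) := by
  refine ⟨(neg_neg _).symm, ?_⟩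
  have := (S.endoLin 𝒜).map_neg (S.endo 𝒜 w)
  simpa [HolData.endoLin_apply, h.endo_endo] using this

/-- The curvature term `ℐ₂` of a homotopy holomorphic symplectic structure is additive in its second
argument as well. -/
theorem HolSympData.IsHolSymplectic.I₂_add_right {S : HolSympData R A} (lie : 𝒜.IsLie)
    (hS : S.IsHolSymplectic 𝒜) (y z z' : VF R) :
    S.hol.I₂ y (z + z') = S.hol.I₂ y z + S.hol.I₂ y z' := by
  have h := hS.hol
  have form₁ := h.form₁
  have form₂ := h.form₂
  -- The anchor of `ℐ₂` is the torsion of `r`, which is additive, so `ρ` kills the additivity defect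
  -- of `ℐ₂`.
  have anchor_add (y z z' : VF R) : 𝒜.anchor (S.hol.I₂ y (z + z')) =
      𝒜.anchor (S.hol.I₂ y z) + 𝒜.anchor (S.hol.I₂ y z') := by
    have e1 := h.mc_two_base y (z + z')
    have e2 := h.mc_two_base y z
    have e3 := h.mc_two_base y z'
    simp only [deltaTwo, EndForm.torsion, map_add, lie_add] at e1 e2 e3
    linear_combination (norm := abel) e2 + e3 - e1
  have re (z : VF R) := hS.bracket_re _ _ (HolData.inL_graph h (y, 0)) (HolData.inL_graph h (z, 0))
  have e1 := re (z + z')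
  have e2 := re z
  have e3 := re z'
  simp only [reExt, imExt, HolData.bracketL, HolSympData.tau, HolData.endo, Prod.fst_neg,
    Prod.snd_neg, map_zero, add_zero, zero_add, neg_neg, map_add, map_neg, lie.zero_left,
    lie.zero_right, form₁.add_left, form₁.add_right, form₁.neg_right, form₁.zero_right, lie_add,
    neg_add, smul_add, smul_sub, smul_neg, lieD_add, lieD_neg, iotaD_add, iotaD_neg, add_iotaD,
    map_sub] at e1 e2 e3
  have symb_eq : S.Ω.symb (S.hol.I₂ y (S.hol.I₁.r z + S.hol.I₁.r z')
      - S.hol.I₂ y (S.hol.I₁.r z) - S.hol.I₂ y (S.hol.I₁.r z')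
      + (S.hol.I₂ (S.hol.I₁.r y) (z + z') - S.hol.I₂ (S.hol.I₁.r y) z
      - S.hol.I₂ (S.hol.I₁.r y) z')) = 0 := by
    simp only [map_add, map_sub]
    linear_combination (norm := abel) e1 - e2 - e3
  have sum_eq : S.hol.I₂ y (S.hol.I₁.r z + S.hol.I₁.r z')
      - S.hol.I₂ y (S.hol.I₁.r z) - S.hol.I₂ y (S.hol.I₁.r z')
      + (S.hol.I₂ (S.hol.I₁.r y) (z + z') - S.hol.I₂ (S.hol.I₁.r y) z
      - S.hol.I₂ (S.hol.I₁.r y) z') = 0 := by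
    -- Both `ρ` and `σ` vanish on this sum of defects, and non-degeneracy makes `(ρ, σ)` injective.
    obtain ⟨π, hπ⟩ := hS.symplectic.nondeg.split
    rw [← hπ (_ + _), symb_eq]
    simp only [map_add 𝒜.anchor, map_sub, anchor_add, add_sub_cancel_left, sub_self, add_zero]
    exact π.map_zero
  have l_eq : S.hol.I₁.l (S.hol.I₂ y (z + z') - S.hol.I₂ y z - S.hol.I₂ y z') = 0 := by
    have e1 := h.sq_two y (z + z')
    have e2 := h.sq_two y z
    have e3 := h.sq_two y z'
    refine two_nsmul_cancel (R := R) ?_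
    simp only [EndForm.fnOne, map_add, lie_add, form₁.add_left, form₁.add_right] at e1 e2 e3
    simp only [map_sub, smul_sub, smul_zero]
    linear_combination (norm := abel) e1 - e2 - e3 - sum_eq
  -- For a defect killed by `ρ` and `l`, the equation `Qρ + l² = -1` says that it is zero.
  have := h.sq_one_l (S.hol.I₂ y (z + z') - S.hol.I₂ y z - S.hol.I₂ y z')
  have ha : 𝒜.anchor (S.hol.I₂ y (z + z') - S.hol.I₂ y z - S.hol.I₂ y z') = 0 := by
    simp [anchor_add]
  simp only [deltaOne, EndForm.sq, LinearMap.comp_apply, l_eq, ha, map_zero, add_zero] at this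
  linear_combination (norm := abel) this

/-- The symmetrised form of `𝕁`-bilinearity. The second-degree part of the equation for `𝒬` directly
gives only this sum on pairs of vector fields, and the sum is enough for the reconstruction. -/
theorem HolData.IsHomotopyHolomorphic.totalBracket_endo_add {S : HolData R A} (lie : 𝒜.IsLie)
    (h : S.IsHomotopyHolomorphic 𝒜) (hadd : ∀ x y z, S.I₂ x (y + z) = S.I₂ x y + S.I₂ x z)
    (w v : VF R × A) :
    S.totalBracket 𝒜 (S.endo 𝒜 w) v + S.totalBracket 𝒜 w (S.endo 𝒜 v) =
      (2 : ℕ) • S.endo 𝒜 (S.totalBracket 𝒜 w v) := by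
  have form₁ := h.form₁
  have form₂ := h.form₂
  obtain ⟨y, a⟩ := w
  obtain ⟨z, b⟩ := v
  have sv (y z : VF R) : ⁅y, z⁆ = -⁅z, y⁆ := (lie_skew y z).symm
  ext1
  · simp only [totalBracket, h.endo_endo]
    have e1 := h.mc_two_base y z
    have e2 := h.sq_one_r ⁅y, z⁆
    have e3 := lie.anchor_bracket a b
    have e4 := h.mc_one.anchor_op y b
    have e5 := h.mc_one.anchor_op z a
    have e6 : S.I₁.r ⁅y, 𝒜.anchor b⁆ = -S.I₁.r ⁅𝒜.anchor b, y⁆ := by rw [sv, map_neg]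
    simp only [deltaOne, deltaTwo, EndForm.torsion, EndForm.sq, LinearMap.comp_apply] at e1 e2
    simp only [endo, bracketL, Prod.fst_add, Prod.fst_neg, map_add, map_sub,
      map_neg, add_lie, lie_add, neg_lie, lie_neg, two_nsmul]
    have e7 := sv (S.I₁.r y) (𝒜.anchor b)
    linear_combination (norm := abel) e1 - e2 - e3 - e4 + e5 + e6 - e7
      + (e1 - e2 - e3 - e4 + e5 + e6 - e7)
  · simp only [totalBracket]
    have e1 := h.mc_one.l_bracket a b
    have e2 := h.mc_one.l_bracket b a
    have e3 := h.sq_one_op y b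
    have e4 := h.mc_two_symb b y
    have e5 := h.sq_one_op z a
    have e6 := h.mc_two_symb a z
    have e7 := h.sq_two y z
    have e8 : S.I₁.l (𝒜.bracket b a) = -S.I₁.l (𝒜.bracket a b) := by rw [lie.skew, map_neg]
    have e9 : S.Q₁ ⁅y, 𝒜.anchor b⁆ = -S.Q₁ ⁅𝒜.anchor b, y⁆ := by rw [sv, map_neg]
    simp only [deltaOne, deltaTwo, EndForm.torsion, EndForm.sq, EndForm.fnOne, two_nsmul]
      at e3 e4 e5 e6 e7
    simp only [endo, bracketL, Prod.snd_add, map_add, map_sub,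
      map_neg, add_lie, lie_add, neg_lie, lie_neg, two_nsmul, lie.add_left, lie.add_right,
      form₁.add_left, form₁.add_right, form₁.neg_left, form₂.add_left, form₂.neg_left, hadd,
      form₂.neg_right hadd]
    linear_combination (norm := abel) -e1 + e2 - e8 + lie.skew b (S.I₁.l a) - e3 + e4 + e5 - e6 - e7
      + lie.skew b (S.Q₁ y) - e9 + form₂.skew hadd (𝒜.anchor b) y - (h.comm ⁅y, z⁆)

end Reconstruction

/-! ### The generalized complex structure of a Lagrangian atlas. -/

section Equivalence

variable {R A : Type*} [CommRing R] [Algebra ℝ R] [AddCommGroup A] [Module R A]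
  {𝒜 : Algebroid R A}

theorem IsTwoForm.skew {β : Bil R} (h : IsTwoForm β) (y z : VF R) : β y z = -β z y := by
  have := h (y + z)
  simp only [map_add, LinearMap.add_apply, h y, h z] at this
  linear_combination this

theorem IsTwoForm.neg {β : Bil R} (h : IsTwoForm β) : IsTwoForm (-β) := fun y => by simp [h y]

/-- The Cartan formula `L_x γ = ι_x dγ + d ι_x γ`. -/
theorem lieBil_eq (γ : Bil R) (x y z : VF R) :
    lieBil x γ y z = dTwo γ x y z + dOne (γ x) y z := by
  simp only [lieBil, dTwo, dOne_apply, iotaD_apply, LinearMap.sub_apply, LinearMap.add_apply,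
    lieD_apply, dFun_apply]
  ring

namespace HolSympData

variable {S : HolSympData R A} {γ γ' : Bil R}

/-- The map `γ^♭ : A → T^*X`. -/
def flat (𝒜 : Algebroid R A) (S : HolSympData R A) (γ : Bil R) : A →ₗ[R] Cov R :=
  S.Ω.symb - γ.comp 𝒜.anchor

/-- The gauge transformation which makes the symbol of the holomorphic form the projection to
`T^*X`. -/
def gaugeForm (S : HolSympData R A) (γ γ' : Bil R) : VF R →ₗ[R] Cov R :=
  S.bil - γ' + γ.comp S.hol.I₁.r

namespace IsLagrangian

variable (hL : S.IsLagrangian 𝒜 γ γ')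

/-- The isomorphism `γ^♭ : A ≃ T^*X` of a Lagrangian structure. -/
def flatEquiv (hL : S.IsLagrangian 𝒜 γ γ') : A ≃ₗ[R] Cov R :=
  LinearEquiv.ofBijective (S.flat 𝒜 γ) hL.flat_bijective

theorem flatEquiv_apply (a : A) : hL.flatEquiv a = S.Ω.symb a - γ (𝒜.anchor a) := rfl

theorem gaugeForm_apply (y : VF R) :
    S.gaugeForm γ γ' y = S.bil y - γ' y + γ (S.hol.I₁.r y) := rfl

/-- The isomorphism `(y, a) ↦ (y, γ^♭ a + k y)` of `TX ⊕ A` with `TX ⊕ T^*X`. -/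
def shear (hL : S.IsLagrangian 𝒜 γ γ') : (VF R × A) ≃ₗ[R] VF R × Cov R where
  toFun w := (w.1, hL.flatEquiv w.2 + S.gaugeForm γ γ' w.1)
  map_add' w v := by
    ext1
    · rfl
    · simp only [Prod.fst_add, Prod.snd_add, map_add]; abel
  map_smul' f w := by
    ext1
    · rfl
    · simp
  invFun W := (W.1, hL.flatEquiv.symm (W.2 - S.gaugeForm γ γ' W.1))
  left_inv w := by simp
  right_inv W := by simp

theorem shear_apply (w : VF R × A) :
    hL.shear w = (w.1, hL.flatEquiv w.2 + S.gaugeForm γ γ' w.1) := rfl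

theorem shear_symm_apply (W : VF R × Cov R) :
    hL.shear.symm W = (W.1, hL.flatEquiv.symm (W.2 - S.gaugeForm γ γ' W.1)) := rfl

/-- This expression is the real part of `S - (γ' + iγ)` on the section `w - i𝕁w` of `L`, which
explains the choice of `gaugeForm`. -/
theorem shear_snd (w : VF R × A) :
    (hL.shear w).2 = S.tau w - γ (S.hol.endo 𝒜 w).1 - γ' w.1 := by
  simp only [shear_apply, flatEquiv_apply, gaugeForm_apply, tau, HolData.endo, map_add, map_neg]
  abel

/-- Closedness gives `op a = dσ(a) + ι_{ρa} ω₁`, so `σ` respects brackets up to a twist by `ω₁`.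
Since `ω₁ = dγ`, subtracting `γ ∘ ρ` removes the twist. -/
theorem flatEquiv_bracket (lie : 𝒜.IsLie) (hS : S.IsHolSymplectic 𝒜) (a b : A) :
    hL.flatEquiv (𝒜.bracket a b) =
      lieD (𝒜.anchor a) (hL.flatEquiv b) - iotaD (𝒜.anchor b) (hL.flatEquiv a) := by
  have h1 := hS.symplectic.closed.delta_symb a b
  have h2 : S.Ω.op a (𝒜.anchor b) =
      iotaD (𝒜.anchor b) (S.Ω.symb a) + S.Ω.three (𝒜.anchor a) (𝒜.anchor b) := by
    ext z
    have := hS.symplectic.closed.d_symb a (𝒜.anchor b) z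
    rw [dOne_apply] at this
    rw [LinearMap.add_apply]
    linear_combination this
  rw [h2, ← hL.d_eq, dTwo_eq] at h1
  simp only [flatEquiv_apply, lie.anchor_bracket, lieD_sub, iotaD_sub]
  rw [h1]
  abel

/-- `𝕁`, transported to `TX ⊕ T^*X`. -/
def genEndo (hL : S.IsLagrangian 𝒜 γ γ') : VF R × Cov R →ₗ[R] VF R × Cov R :=
  hL.shear.toLinearMap.comp ((S.hol.endoLin 𝒜).comp hL.shear.symm.toLinearMap)

theorem genEndo_shear (w : VF R × A) : hL.genEndo (hL.shear w) = hL.shear (S.hol.endo 𝒜 w) := by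
  simp [genEndo, HolData.endoLin_apply]

theorem genEndo_sq (hS : S.IsHolSymplectic 𝒜) (W : VF R × Cov R) :
    hL.genEndo (hL.genEndo W) = -W := by
  obtain ⟨w, rfl⟩ := hL.shear.surjective W
  rw [genEndo_shear, genEndo_shear, hS.hol.endo_endo, map_neg]

/-- The real part of the skewness of `S` on sections `w - i𝕁w`; the contributions of `γ` and `γ'`
cancel because both forms are alternating. -/
theorem pairing_genEndo (hS : S.IsHolSymplectic 𝒜) (W V : VF R × Cov R) :
    pairing (hL.genEndo W) (hL.genEndo V) = pairing W V := by
  obtain ⟨w, rfl⟩ := hL.shear.surjective W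
  obtain ⟨v, rfl⟩ := hL.shear.surjective V
  have h := hS.skew_re _ _ (HolData.inL_graph hS.hol w) (HolData.inL_graph hS.hol v)
  simp only [reExt] at h
  have ht (w : VF R × A) : S.tau (-w) = -S.tau w := by simp [tau]; abel
  simp only [ht, Prod.fst_neg, map_neg, LinearMap.neg_apply, neg_neg] at h
  simp only [genEndo_shear, pairing, shear_snd, hS.hol.endo_endo, LinearMap.sub_apply,
    Prod.fst_neg, map_neg, LinearMap.neg_apply]
  simp only [shear_apply]
  rw [hL.form.skew v.1, hL.form.skew w.1, hL.form'.skew w.1 v.1,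
    hL.form'.skew (S.hol.endo 𝒜 w).1]
  linear_combination -h

/-- The real part of the closedness equation of `S` on sections `w - i𝕁w`. The three-forms are `dγ`
and `dγ'`, so the shift by `γ' + iγ` absorbs them. -/
theorem shear_totalBracket_add (lie : 𝒜.IsLie) (hS : S.IsHolSymplectic 𝒜) (w v : VF R × A) :
    hL.shear (S.hol.totalBracket 𝒜 (S.hol.endo 𝒜 w) v + S.hol.totalBracket 𝒜 w (S.hol.endo 𝒜 v)) =
      (2 : ℕ) • (dorfman (hL.shear (S.hol.endo 𝒜 w)) (hL.shear (S.hol.endo 𝒜 v)) -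
        dorfman (hL.shear w) (hL.shear v)) := by
  have hadd := hS.I₂_add_right lie
  have form₁ := hS.hol.form₁
  have form₂ := hS.hol.form₂
  have hH := hS.hol.totalBracket_endo_add lie hadd w v
  ext1
  · simp only [shear_apply, dorfman, HolData.totalBracket, hS.hol.endo_endo, Prod.fst_add,
      Prod.fst_neg, neg_lie, lie_neg, Prod.fst_sub, two_nsmul]
    abel
  · have re := hS.bracket_re _ _ (HolData.inL_graph hS.hol w) (HolData.inL_graph hS.hol v)
    have Bneg_left (w v : VF R × A) : S.hol.bracketL 𝒜 (-w) v = -S.hol.bracketL 𝒜 w v := by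
      simp only [HolData.bracketL, Prod.fst_neg, Prod.snd_neg, lie.neg_left, form₁.neg_left,
        form₁.neg_right, form₂.neg_left, neg_lie, map_neg]
      abel
    have Bneg_right (w v : VF R × A) : S.hol.bracketL 𝒜 w (-v) = -S.hol.bracketL 𝒜 w v := by
      simp only [HolData.bracketL, Prod.fst_neg, Prod.snd_neg, lie.neg_right, form₁.neg_left,
        form₁.neg_right, form₂.neg_right hadd, lie_neg, map_neg]
      abel
    have tau_neg (w : VF R × A) : S.tau (-w) = -S.tau w := by simp [tau]; abel
    -- By `shear_snd` the shear involves the vector part of `𝕁` of its argument; here `𝕁(2𝕁T) =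
    -- -2T`.
    have endo_sum : (S.hol.endo 𝒜 (S.hol.totalBracket 𝒜 (S.hol.endo 𝒜 w) v
        + S.hol.totalBracket 𝒜 w (S.hol.endo 𝒜 v))).1 =
        -((2 : ℕ) • (S.hol.totalBracket 𝒜 w v).1) := by
      rw [hH, ← HolData.endoLin_apply, map_nsmul, HolData.endoLin_apply, hS.hol.endo_endo]
      simp
    rw [shear_snd, endo_sum]
    simp only [reExt, imExt, Bneg_left, Bneg_right, tau_neg, Prod.fst_neg, lieD_neg, neg_lieD,
      iotaD_neg, neg_iotaD, neg_lie, lie_neg, map_neg, neg_neg, LinearMap.neg_apply, map_add,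
      map_sub, two_nsmul] at re
    simp only [← hL.d_eq, ← hL.d_eq', dTwo_eq] at re
    simp only [dorfman, Prod.snd_add, Prod.snd_sub, shear_snd, hS.hol.endo_endo, Prod.fst_neg,
      map_neg, lieD_sub, lieD_neg, iotaD_sub, iotaD_neg, two_nsmul]
    simp only [shear_apply, HolData.totalBracket, hS.hol.endo_endo, tau, Prod.fst_add,
      Prod.snd_add, Prod.fst_neg, neg_lie, lie_neg, map_add, map_neg] at re ⊢
    linear_combination (norm := abel) -re

/-- Comparing the two symmetrised formulas gives `J T(w, v) = [Jw, Jv] - [w, v]`. Inserting this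
into `J` of the relation `T(𝕁w, v) + T(w, 𝕁v) = 2𝕁T(w, v)` recovers `T` itself. -/
theorem shear_totalBracket (lie : 𝒜.IsLie) (hS : S.IsHolSymplectic 𝒜) (w v : VF R × A) :
    hL.shear (S.hol.totalBracket 𝒜 w v) =
      dorfman (hL.genEndo (hL.shear w)) (hL.shear v) +
        dorfman (hL.shear w) (hL.genEndo (hL.shear v)) := by
  have hadd := hS.I₂_add_right lie
  have key (w v) : hL.genEndo (hL.shear (S.hol.totalBracket 𝒜 w v)) =
      dorfman (hL.genEndo (hL.shear w)) (hL.genEndo (hL.shear v)) -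
        dorfman (hL.shear w) (hL.shear v) := by
    have h := hL.shear_totalBracket_add lie hS w v
    rw [hS.hol.totalBracket_endo_add lie hadd, map_nsmul, ← genEndo_shear] at h
    rw [two_nsmul_cancel (R := R) h, genEndo_shear, genEndo_shear]
  have h := congrArg hL.shear (hS.hol.totalBracket_endo_add lie hadd w v)
  rw [map_add, map_nsmul, ← genEndo_shear] at h
  have h' := congrArg hL.genEndo h
  rw [map_add, map_nsmul, key, key, hL.genEndo_sq hS, ← genEndo_shear, ← genEndo_shear,
    hL.genEndo_sq hS, hL.genEndo_sq hS, neg_dorfman, dorfman_neg] at h'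
  refine two_nsmul_cancel (R := R) ?_
  rw [smul_neg] at h'
  linear_combination (norm := abel) h'

/-- The generalized complex structure determined by a homotopy holomorphic symplectic structure and
a Lagrangian structure on the atlas. -/
def genComplex (lie : 𝒜.IsLie) (hS : S.IsHolSymplectic 𝒜) (hL : S.IsLagrangian 𝒜 γ γ') :
    GenComplex R where
  J := hL.genEndo
  sq := hL.genEndo_sq hS
  orthogonal := hL.pairing_genEndo hS
  integrable W V := by
    rw [courant_integrable_iff _ (hL.genEndo_sq hS) (hL.pairing_genEndo hS)]
    obtain ⟨w, rfl⟩ := hL.shear.surjective W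
    obtain ⟨v, rfl⟩ := hL.shear.surjective V
    have h := hL.shear_totalBracket_add lie hS w v
    rw [hS.hol.totalBracket_endo_add lie (hS.I₂_add_right lie), map_nsmul, ← genEndo_shear] at h
    rw [← hL.shear_totalBracket lie hS, two_nsmul_cancel (R := R) h, genEndo_shear, genEndo_shear]

end IsLagrangian

end HolSympData

end Equivalence

/-! ### The equivalence with the normal form, and uniqueness. -/

section Uniqueness

variable {R A : Type*} [CommRing R] [Algebra ℝ R] [AddCommGroup A] [Module R A]
  {𝒜 : Algebroid R A} {S : HolSympData R A} {γ γ' : Bil R}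

namespace HolSympData.IsLagrangian

variable (lie : 𝒜.IsLie) (hS : S.IsHolSymplectic 𝒜) (hL : S.IsLagrangian 𝒜 γ γ')

theorem genComplex_J (W : VF R × Cov R) :
    (hL.genComplex lie hS).J W = hL.shear (S.hol.endo 𝒜 (hL.shear.symm W)) := rfl

theorem genComplex_P (α : Cov R) :
    (hL.genComplex lie hS).P α = 𝒜.anchor (hL.flatEquiv.symm α) := by
  simp [GenComplex.P, genComplex_J, shear_apply, shear_symm_apply, HolData.endo]

theorem genComplex_It (α : Cov R) : (hL.genComplex lie hS).It α =
    hL.flatEquiv (S.hol.I₁.l (hL.flatEquiv.symm α)) +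
      S.gaugeForm γ γ' (𝒜.anchor (hL.flatEquiv.symm α)) := by
  simp [GenComplex.It, genComplex_J, shear_apply, shear_symm_apply, HolData.endo]

theorem genComplex_I (y : VF R) : (hL.genComplex lie hS).I y =
    S.hol.I₁.r y + 𝒜.anchor (hL.flatEquiv.symm (S.gaugeForm γ γ' y)) := by
  simp [GenComplex.I, genComplex_J, shear_apply, shear_symm_apply, HolData.endo]
  abel

theorem genComplex_Q (y : VF R) : (hL.genComplex lie hS).Q y =
    hL.flatEquiv (S.hol.Q₁ y) - S.gaugeForm γ γ' (S.hol.I₁.r y)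
      - hL.flatEquiv (S.hol.I₁.l (hL.flatEquiv.symm (S.gaugeForm γ γ' y)))
      - S.gaugeForm γ γ' (𝒜.anchor (hL.flatEquiv.symm (S.gaugeForm γ γ' y))) := by
  simp [GenComplex.Q, genComplex_J, shear_apply, shear_symm_apply, HolData.endo]
  abel

theorem flatEquiv_bracket_poisson (a b : A) : hL.flatEquiv (𝒜.bracket a b) =
    (poissonAlgebroid (hL.genComplex lie hS).P).bracket (hL.flatEquiv a) (hL.flatEquiv b) := by
  rw [hL.flatEquiv_bracket lie hS]
  simp [poissonAlgebroid, genComplex_P]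

theorem totalBracket_genComplex (W V : VF R × Cov R) :
    (hL.genComplex lie hS).inducedHol.totalBracket
        (poissonAlgebroid (hL.genComplex lie hS).P) W V =
      hL.shear (S.hol.totalBracket 𝒜 (hL.shear.symm W) (hL.shear.symm V)) := by
  rw [GenComplex.totalBracket_inducedHol, hL.shear_totalBracket lie hS,
    LinearEquiv.apply_symm_apply, LinearEquiv.apply_symm_apply]
  rfl

/-- The shear intertwines the endomorphisms and the total brackets; reading this off in components
gives exactly the gauge transformation by `gaugeForm`. -/
theorem inducedHol_genComplex : (hL.genComplex lie hS).inducedHol =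
    (S.hol.map hL.flatEquiv).gauge (poissonAlgebroid (hL.genComplex lie hS).P)
      (S.gaugeForm γ γ') := by
  have form₁ := hS.hol.form₁
  have form₂ := hS.hol.form₂
  have hadd := hS.I₂_add_right lie
  have form₁' := (hL.genComplex lie hS).inducedHol_isForm
  have lie' := (hL.genComplex lie hS).poissonAlgebroid_isLie
  have form₂' : IsTwoFormValued (hL.genComplex lie hS).inducedHol.I₂ :=
    (hL.genComplex lie hS).dTwo_Q_isTwoFormValued
  have hadd' : ∀ x y z, (hL.genComplex lie hS).inducedHol.I₂ x (y + z) = _ :=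
    (hL.genComplex lie hS).dTwo_Q_add_right
  have Q_eq (y : VF R) : (hL.genComplex lie hS).inducedHol.Q₁ y = _ := hL.genComplex_Q lie hS y
  have anchor_eq (α : Cov R) : (poissonAlgebroid (hL.genComplex lie hS).P).anchor α = _ :=
    hL.genComplex_P lie hS α
  refine HolData.ext (EndForm.ext ?_ ?_ ?_) ?_ ?_
  · funext y α
    have h := congrArg Prod.snd (hL.totalBracket_genComplex lie hS (y, 0) (0, α))
    simp only [HolData.totalBracket, HolData.bracketL, HolData.endo, shear_apply, shear_symm_apply,
      form₁.zero_left, form₂.zero_right hadd, form₁'.zero_left,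
      form₂'.zero_right hadd', lie'.zero_left, lie.neg_left, map_zero, map_neg, neg_zero, sub_zero,
      zero_sub, zero_add, add_zero, lie_zero, map_add,
      flatEquiv_bracket_poisson lie hS hL, LinearEquiv.apply_symm_apply] at h
    simp only [HolData.gauge, HolData.map, EndForm.map, deltaOne, anchor_eq]
    rw [h, lie'.skew α, ← lie_skew y, map_neg]
    abel
  · refine LinearMap.ext fun α => (hL.genComplex_It lie hS α).trans ?_
    simp [HolData.gauge, HolData.map, EndForm.map, deltaOne, anchor_eq]
  · refine LinearMap.ext fun y => (hL.genComplex_I lie hS y).trans ?_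
    simp [HolData.gauge, HolData.map, EndForm.map, deltaOne, anchor_eq]
  · funext y z
    have h := congrArg Prod.snd (hL.totalBracket_genComplex lie hS (y, 0) (z, 0))
    simp only [HolData.totalBracket, HolData.bracketL, HolData.endo, shear_apply, shear_symm_apply,
      form₁.neg_right, form₁'.zero_right, lie'.zero_left, lie.neg_left, lie.neg_right,
      map_zero, map_neg, map_sub, neg_neg, sub_zero, zero_sub, zero_add, add_zero, map_add,
      neg_lie, lie_neg, add_lie, lie_add, Q_eq,
      flatEquiv_bracket_poisson lie hS hL, LinearEquiv.apply_symm_apply] at h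
    simp only [HolData.gauge, HolData.map, EndForm.map, EndForm.fnOne, anchor_eq,
      LinearMap.comp_apply, LinearEquiv.coe_coe]
    linear_combination (norm := abel) h
  · refine LinearMap.ext fun y => (hL.genComplex_Q lie hS y).trans ?_
    simp [HolData.gauge, HolData.map, EndForm.map, anchor_eq]

theorem equivalent_genComplex : Equivalent 𝒜 S γ γ'
    (poissonAlgebroid (hL.genComplex lie hS).P) (hL.genComplex lie hS).induced 0 0 := by
  -- The choice `μ = -(γ' + iγ)` is forced, since the Lagrangian structure of the target is zero.
  refine ⟨hL.flatEquiv, S.gaugeForm γ γ', -γ, -γ', fun a => ?_,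
    hL.flatEquiv_bracket_poisson lie hS, hL.inducedHol_genComplex lie hS, hL.form.neg,
    hL.form'.neg, fun a => ?_, fun a y z => ?_, fun y z => ?_, fun y => ?_, fun y z => ?_,
    (add_neg_cancel γ).symm, (add_neg_cancel γ').symm⟩
  · change (hL.genComplex lie hS).P _ = _
    simp [genComplex_P]
  · change hL.flatEquiv a = S.Ω.symb a + -γ (𝒜.anchor a)
    rw [flatEquiv_apply, sub_eq_add_neg]
  · change dOne (hL.flatEquiv a) y z = _
    have h := hS.symplectic.closed.d_symb a y z
    rw [← hL.d_eq, dOne_apply] at h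
    simp only [lieBil_eq, dTwo_neg, flatEquiv_apply, dOne_apply, iotaD_sub,
      LinearMap.neg_apply, iotaD_neg, LinearMap.sub_apply]
    linear_combination -h
  · change 0 = _
    rw [dTwo_neg, hL.d_eq, add_neg_cancel]
  · change 0 + S.gaugeForm γ γ' y = S.bil y + -γ' y - -γ (S.hol.I₁.r y)
    rw [gaugeForm_apply]
    abel
  · change 0 = _
    rw [dTwo_neg, hL.d_eq', add_neg_cancel]

end HolSympData.IsLagrangian

theorem GenComplex.ext_components {J K : GenComplex R} (hI : J.I = K.I) (hP : J.P = K.P)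
    (hQ : J.Q = K.Q) (hIt : J.It = K.It) : J = K := by
  refine GenComplex.ext (LinearMap.ext fun w => ?_)
  rw [J_apply, J_apply, hI, hP, hQ, hIt]

/-- The generalized complex structure inducing a given structure is unique. -/
theorem Equivalent.genComplex_unique {J K : GenComplex R}
    (hJ : Equivalent 𝒜 S γ γ' (poissonAlgebroid J.P) J.induced 0 0)
    (hK : Equivalent 𝒜 S γ γ' (poissonAlgebroid K.P) K.induced 0 0) : J = K := by
  obtain ⟨φ, k, lam, lam', hρ, -, hhol, -, -, hsymb, -, -, hbil, -, hγ, hγ'⟩ := hJ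
  obtain ⟨ψ, m, mu, mu', hρK, -, hholK, -, -, hsymbK, -, -, hbilK, -, hγK, hγK'⟩ := hK
  obtain rfl : mu = lam := 
    (neg_eq_of_add_eq_zero_right hγK.symm).symm.trans (neg_eq_of_add_eq_zero_right hγ.symm)
  obtain rfl : mu' = lam' := 
    (neg_eq_of_add_eq_zero_right hγK'.symm).symm.trans (neg_eq_of_add_eq_zero_right hγ'.symm)
  -- The symbol of the canonical form is the identity, so the symbol equation reads `φ a = σ a + λ(ρ
  -- a)`.
  obtain rfl : ψ = φ := LinearEquiv.ext fun a => (hsymbK a).trans (hsymb a).symm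
  -- The homotopy datum `b` of the target is zero, so its equation determines `k`.
  obtain rfl : m = k := LinearMap.ext fun y => by
    have h := (hbilK y).trans (hbil y).symm
    simpa [GenComplex.induced, canonicalForm] using h
  have hP : J.P = K.P := LinearMap.ext fun α => by
    obtain ⟨a, rfl⟩ := ψ.surjective α
    exact (hρ a).trans (hρK a).symm
  have h : J.inducedHol = K.inducedHol := by
    change J.inducedHol = _ at hhol
    change K.inducedHol = _ at hholK
    rw [hhol, hholK, hP]
  exact GenComplex.ext_components (congrArg (fun T => T.I₁.r) h) hP (congrArg HolData.Q₁ h)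
    (congrArg (fun T => T.I₁.l) h)

end Uniqueness

end GCStack

end

/-! ### The theorem over the algebra of smooth functions on a manifold. -/

open GCStack in
theorem mainTheorem1 {E : Type*} [NormedAddCommGroup E] [NormedSpace ℝ E] [FiniteDimensional ℝ E]
    {H : Type*} [TopologicalSpace H] (I : ModelWithCorners ℝ E H) [I.Boundaryless]
    (X : Type*) [TopologicalSpace X] [ChartedSpace H X] [IsManifold I ∞ X] [T2Space X]
    [SigmaCompactSpace X]
    (F : Type*) [NormedAddCommGroup F] [NormedSpace ℝ F] [FiniteDimensional ℝ F]
    (A : X → Type*) [TopologicalSpace (Bundle.TotalSpace F A)] [∀ x, AddCommGroup (A x)]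
    [∀ x, Module ℝ (A x)] [∀ x, TopologicalSpace (A x)] [FiberBundle F A] [VectorBundle ℝ F A]
    [ContMDiffVectorBundle ∞ F A I] :
    (∀ J : GenComplex C^∞⟮I, X; ℝ⟯,
      IsPoisson J.P ∧
      (poissonAlgebroid J.P).IsLie ∧
      J.inducedHol.IsHomotopyHolomorphic (poissonAlgebroid J.P) ∧
      (canonicalForm C^∞⟮I, X; ℝ⟯).IsSymplectic (poissonAlgebroid J.P) ∧
      J.induced.IsHolSymplectic (poissonAlgebroid J.P) ∧
      J.induced.IsLagrangian (poissonAlgebroid J.P) 0 0) ∧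
    (∀ (𝒜 : Algebroid C^∞⟮I, X; ℝ⟯ Cₛ^∞⟮I; F, A⟯)
      (S : HolSympData C^∞⟮I, X; ℝ⟯ Cₛ^∞⟮I; F, A⟯) (γ γ' : Bil C^∞⟮I, X; ℝ⟯),
      𝒜.IsLie → S.IsHolSymplectic 𝒜 → S.IsLagrangian 𝒜 γ γ' →
      ∃! J : GenComplex C^∞⟮I, X; ℝ⟯,
        Equivalent 𝒜 S γ γ' (poissonAlgebroid J.P) J.induced 0 0) := by
  refine ⟨fun J => ⟨J.isPoisson, J.poissonAlgebroid_isLie, J.inducedHol_isHomotopyHolomorphic,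
    J.canonicalForm_isSymplectic, J.induced_isHolSymplectic, J.induced_isLagrangian⟩,
    fun 𝒜 S γ γ' lie hS hL => ?_⟩
  exact ⟨hL.genComplex lie hS, hL.equivalent_genComplex lie hS,
    fun K hK => hK.genComplex_unique (hL.equivalent_genComplex lie hS)⟩
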